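/- Let $P$ be a right Ore monoid, that is, (O1) for all $x_1,x_2\in P$ there are $y_1,y_2\in P$ with $x_1y_1=x_2y_2$, and (O2) if $xy_1=xy_2$ in $P$, then there is $z\in P$ with $y_1z=y_2z$. A correspondence from a $\mathrm C^*$-algebra $A$ to a $\mathrm C^*$-algebra $B$ is a (right) Hilbert $B$-module with a nondegenerate left action of $A$ by adjointable operators; it is proper if $A$ acts by compact operators. Let $(A,\mathcal E_p,\mu_{p,q})_{p,q\in P}$ be a proper product system over $P$: $A$ is a $\mathrm C^*$-algebra, the $\mathcal E_p$ are proper correspondences from $A$ to itself with $\mathcal E_1\cong A$, and the $\mu_{p,q}\colon \mathcal E_p\otimes_A\mathcal E_q\to\mathcal E_{pq}$ are isomorphisms of correspondences that are associative and are given by the left and right module structures if $p=1$ or $q=1$. Let $\varphi_p\colon A\to\mathbb K(\mathcal E_p)$ be the left action, let $I=\overline{\bigcup_{p\in P}\ker\varphi_p}$, which is a closed two-sided ideal of $A$, and let $A'=A/I$, with quotient map $\pi\colon A\to A'$, and $\mathcal E'_p=\mathcal E_p\otimes_A A'$. Then: 1. There are surjective bounded linear maps $q_p\colon\mathcal E_p\to\mathcal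 E'_p$ with $q_p(\xi a)=\xi\otimes\pi(a)$ and with kernel the closed linear span of $\mathcal E_p\cdot I$. The left action of $A$ on $\mathcal E'_p$ descends to $A'$, and there are maps $\mu'_{p,q}$ with $\mu'_{p,q}(q_p(\xi)\otimes q_q(\eta))=q_{pq}(\mu_{p,q}(\xi\otimes\eta))$ such that $(A',\mathcal E'_p,\mu'_{p,q})$ is a proper product system over $P$, where $\mathcal E'_1\cong A'$ is induced by $\mathcal E_1\cong A$. 2. For every $p\in P$, the left action $A'\to\mathbb K(\mathcal E'_p)$ is faithful. 3. Both systems have the same nondegenerate representations. Here a nondegenerate representation of $(A,\mathcal E_p,\mu_{p,q})$ on a Hilbert module $\mathcal F$ over a $\mathrm C^*$-algebra $B$ consists of a nondegenerate left action of $A$ on $\mathcal F$ by adjointable operators and linear maps $S_p\colon\mathcal E_p\to\mathbb B(\mathcal F)$ for $p\in P$, with $S_1$ the given action of $A=\mathcal E_1$, such that $S_p(a\xi)=aS_p(\xi)$, $S_p(\xi)^*S_p(\eta)=\langle\xi,\eta\rangle_A$, $S_p(\xi)S_q(\zeta)=S_{pq}(\mu_{p,q}(\xi\otimes\zeta))$,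 and $S_p(\mathcal E_p)\mathcal F$ spans a dense subspace of $\mathcal F$ for all $p\in P$. For all $B$ and $\mathcal F$, the map $(S'_p)_p\mapsto(S'_p\circ q_p)_p$ is a bijection from the nondegenerate representations of $(A',\mathcal E'_p,\mu'_{p,q})$ on $\mathcal F$ to those of $(A,\mathcal E_p,\mu_{p,q})$ on $\mathcal F$. 4. Both systems have the same Cuntz--Pimsner algebra, the universal $\mathrm C^*$-algebra for Cuntz--Pimsner covariant representations: there is a $^*$-isomorphism from the Cuntz--Pimsner algebra of $(A,\mathcal E_p,\mu_{p,q})$ to that of $(A',\mathcal E'_p,\mu'_{p,q})$ that maps the canonical image of $\xi\in\mathcal E_p$ to the canonical image of $q_p(\xi)\in\mathcal E'_p$, for all $p\in P$. -/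

import Mathlib

open scoped TensorProduct ComplexConjugate ENNReal

theorem isClosed_setOf_exists_star_mul_self (B : Type*) [NonUnitalCStarAlgebra B] :
    IsClosed {x : B | ∃ b, x = star b * b} := by
  let _ := CStarAlgebra.spectralOrder B
  let _ := CStarAlgebra.spectralOrderedRing B
  simp_rw [← CStarAlgebra.nonneg_iff_eq_star_mul_self]
  exact CStarAlgebra.isClosed_nonneg

/-- A complex vector space with a right action of the C⋆-algebra `B` and a positive semidefinite
`B`-valued inner product that is conjugate-linear in the first and linear in the second variable.
Positive elements of `B` are those of the form `star b * b`. -/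
structure PreHilbertModule.{v, u} (B : Type u) [NonUnitalCStarAlgebra B] where
  carrier : Type v
  [addCommGroup : AddCommGroup carrier]
  [module : Module ℂ carrier]
  rsmul : carrier →ₗ[ℂ] B →ₗ[ℂ] carrier
  inner : carrier →ₗ⋆[ℂ] carrier →ₗ[ℂ] B
  rsmul_rsmul : ∀ x a b, rsmul (rsmul x a) b = rsmul x (a * b)
  inner_rsmul : ∀ x y b, inner x (rsmul y b) = inner x y * b
  star_inner : ∀ x y, star (inner x y) = inner y x
  inner_self : ∀ x, ∃ b, inner x x = star b * b

attribute [instance] PreHilbertModule.addCommGroup PreHilbertModule.module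

/-- A (right) Hilbert module over the C⋆-algebra `B`: a right `B`-module, written `rsmul x b` for
`x · b`, with a `B`-valued inner product `inner x y`, linear in the second variable, that is
complete for the norm `‖⟨x, x⟩‖ ^ (1 / 2)`. (The class `CStarModule` of Mathlib describes
left modules and does not include completeness.) -/
structure HilbertModule.{v, u} (B : Type u) [NonUnitalCStarAlgebra B] where
  carrier : Type v
  [normedAddCommGroup : NormedAddCommGroup carrier]
  [normedSpace : NormedSpace ℂ carrier]
  [completeSpace : CompleteSpace carrier]
  rsmul : carrier →ₗ[ℂ] B →ₗ[ℂ] carrier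
  inner : carrier →ₗ⋆[ℂ] carrier →ₗ[ℂ] B
  rsmul_rsmul : ∀ x a b, rsmul (rsmul x a) b = rsmul x (a * b)
  inner_rsmul : ∀ x y b, inner x (rsmul y b) = inner x y * b
  star_inner : ∀ x y, star (inner x y) = inner y x
  inner_self : ∀ x, ∃ b, inner x x = star b * b
  norm_sq : ∀ x, ‖x‖ ^ 2 = ‖inner x x‖

attribute [instance] HilbertModule.normedAddCommGroup HilbertModule.normedSpace
  HilbertModule.completeSpace

instance {B : Type*} [NonUnitalCStarAlgebra B] : CoeSort (HilbertModule B) (Type _) :=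
  ⟨HilbertModule.carrier⟩

namespace PreHilbertModule

variable {B : Type*} [NonUnitalCStarAlgebra B] (X : PreHilbertModule B)

instance : CoeSort (PreHilbertModule B) (Type _) := ⟨carrier⟩

theorem inner_rsmul_left (x y : X) (b : B) : X.inner (X.rsmul x b) y = star b * X.inner x y := by
  rw [← X.star_inner, X.inner_rsmul, star_mul, X.star_inner]

/-- The Cauchy-Schwarz inequality. -/
theorem norm_inner_sq_le (x y : X) : ‖X.inner x y‖ ^ 2 ≤ ‖X.inner x x‖ * ‖X.inner y y‖ := by
  let _ := CStarAlgebra.spectralOrder B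
  let _ := CStarAlgebra.spectralOrderedRing B
  have hpos : ∀ z : X, 0 ≤ X.inner z z := fun z =>
    CStarAlgebra.nonneg_iff_eq_star_mul_self.2 (X.inner_self z)
  set c := X.inner x y with hc
  have hyx : X.inner y x = star c := (X.star_inner x y).symm
  have key : ∀ ε : ℝ, 0 < ε → ‖c‖ ^ 2 ≤ (‖X.inner x x‖ + ε) * ‖X.inner y y‖ := by
    intro ε hε
    set N := ‖X.inner x x‖ + ε with hN
    have hNpos : 0 < N := by positivity
    set t : ℝ := N⁻¹ with ht
    have htpos : 0 < t := by positivity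
    have h1 : 0 ≤ t ^ 2 • (star c * X.inner x x * c) - (2 * t) • (star c * c) + X.inner y y := by
      have h := hpos (X.rsmul x ((t : ℂ) • c) - y)
      have e : X.inner (X.rsmul x ((t : ℂ) • c) - y) (X.rsmul x ((t : ℂ) • c) - y)
          = t ^ 2 • (star c * X.inner x x * c) - (2 * t) • (star c * c) + X.inner y y := by
        simp only [map_sub, LinearMap.sub_apply, X.inner_rsmul, X.inner_rsmul_left, hyx, ← hc,
          star_smul, smul_mul_assoc, mul_smul_comm, mul_assoc]
        simp only [RCLike.star_def, Complex.conj_ofReal, Complex.coe_smul, smul_smul]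
        rw [two_mul, add_smul, sq]
        abel
      rwa [e] at h
    have h2 : star c * X.inner x x * c ≤ N • (star c * c) := by
      refine (CStarAlgebra.star_left_conjugate_le_norm_smul
        (hb := X.star_inner x x)).trans ?_
      have : 0 ≤ star c * c := star_mul_self_nonneg c
      exact smul_le_smul_of_nonneg_right (by simp [hN, hε.le]) this
    have h3 : t • (star c * c) ≤ X.inner y y := by
      have h4 : t ^ 2 • (star c * X.inner x x * c) ≤ t • (star c * c) := by
        calc t ^ 2 • (star c * X.inner x x * c) ≤ t ^ 2 • (N • (star c * c)) :=
              smul_le_smul_of_nonneg_left h2 (by positivity)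
          _ = t • (star c * c) := by
              rw [smul_smul]; congr 1; rw [ht]; field_simp
      have h5 : 0 ≤ t • (star c * c) - (2 * t) • (star c * c) + X.inner y y :=
        h1.trans (by gcongr)
      have e : t • (star c * c) - (2 * t) • (star c * c) + X.inner y y
          = X.inner y y - t • (star c * c) := by
        rw [two_mul, add_smul]; abel
      rw [e] at h5
      exact sub_nonneg.1 h5
    have h6 := CStarAlgebra.norm_le_norm_of_nonneg_of_le
      (ha := smul_nonneg htpos.le (star_mul_self_nonneg c)) h3
    rw [norm_smul, CStarRing.norm_star_mul_self, Real.norm_of_nonneg htpos.le] at h6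
    calc ‖c‖ ^ 2 = N * (t * (‖c‖ * ‖c‖)) := by rw [ht]; field_simp
      _ ≤ N * ‖X.inner y y‖ := by gcongr
  refine le_of_forall_pos_le_add fun δ hδ => ?_
  have hd : 0 < ‖X.inner y y‖ + 1 := by positivity
  have := key (δ / (‖X.inner y y‖ + 1)) (by positivity)
  refine this.trans ?_
  rw [add_mul]
  gcongr
  rw [div_mul_eq_mul_div, div_le_iff₀ hd]
  nlinarith

noncomputable instance : Norm X.carrier := ⟨fun x => √‖X.inner x x‖⟩

theorem norm_def (x : X.carrier) : ‖x‖ = √‖X.inner x x‖ := rfl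

theorem norm_sq (x : X.carrier) : ‖x‖ ^ 2 = ‖X.inner x x‖ := by
  rw [norm_def, Real.sq_sqrt (norm_nonneg _)]

theorem norm_inner_le (x y : X.carrier) : ‖X.inner x y‖ ≤ ‖x‖ * ‖y‖ := by
  have h := X.norm_inner_sq_le x y
  rw [← X.norm_sq, ← X.norm_sq, ← mul_pow] at h
  exact le_of_sq_le_sq h (mul_nonneg (Real.sqrt_nonneg _) (Real.sqrt_nonneg _))

theorem seminormedCore : SeminormedSpace.Core ℂ X.carrier where
  norm_nonneg _ := Real.sqrt_nonneg _
  norm_smul c x := by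
    rw [norm_def, norm_def]
    have : X.inner (c • x) (c • x) = (conj c * c) • X.inner x x := by
      rw [X.inner.map_smulₛₗ, LinearMap.smul_apply, map_smul, smul_smul]
    rw [this, norm_smul, norm_mul, RCLike.norm_conj, Real.sqrt_mul (by positivity),
      Real.sqrt_mul_self (norm_nonneg _)]
  norm_triangle x y := by
    refine le_of_sq_le_sq ?_ (add_nonneg (Real.sqrt_nonneg _) (Real.sqrt_nonneg _))
    have hx := X.norm_inner_le x y
    have hy := X.norm_inner_le y x
    rw [norm_sq]
    have e : X.inner (x + y) (x + y)
        = X.inner x x + X.inner x y + (X.inner y x + X.inner y y) := by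
      simp only [map_add, LinearMap.add_apply]
      abel
    rw [e]
    calc _ ≤ ‖X.inner x x‖ + ‖X.inner x y‖ + (‖X.inner y x‖ + ‖X.inner y y‖) :=
          (norm_add_le _ _).trans (add_le_add (norm_add_le _ _) (norm_add_le _ _))
      _ ≤ (‖x‖ + ‖y‖) ^ 2 := by rw [← X.norm_sq, ← X.norm_sq]; nlinarith

noncomputable instance : SeminormedAddCommGroup X.carrier := .ofCore X.seminormedCore
noncomputable instance : NormedSpace ℂ X.carrier where
  norm_smul_le c x := (X.seminormedCore.norm_smul c x).le

theorem norm_rsmul_le (x : X) (b : B) : ‖X.rsmul x b‖ ≤ ‖x‖ * ‖b‖ := by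
  refine le_of_sq_le_sq ?_ (mul_nonneg (norm_nonneg _) (norm_nonneg _))
  rw [norm_sq, mul_pow, norm_sq, X.inner_rsmul, X.inner_rsmul_left]
  calc _ ≤ ‖star b‖ * ‖X.inner x x‖ * ‖b‖ :=
        (norm_mul_le _ _).trans (mul_le_mul_of_nonneg_right (norm_mul_le _ _) (norm_nonneg _))
    _ = _ := by rw [norm_star]; ring

open UniformSpace

/-- The right action as a bounded bilinear map. -/
noncomputable def rsmulL : X →L[ℂ] B →L[ℂ] X :=
  X.rsmul.mkContinuous₂ 1 fun x b => by simpa using X.norm_rsmul_le x b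

/-- The inner product as a bounded sesquilinear map. -/
noncomputable def innerL : X →L⋆[ℂ] X →L[ℂ] B :=
  X.inner.mkContinuous₂ 1 fun x y => by simpa using X.norm_inner_le x y

/-- The right action, extended to the completion. -/
noncomputable def rsmulC : Completion X →L[ℂ] B →L[ℂ] Completion X :=
  ((ContinuousLinearMap.compL ℂ B X (Completion X) Completion.toComplL).comp X.rsmulL).extend
    (Completion.toComplL : X →L[ℂ] Completion X)

/-- The inner product, extended to the completion. -/
noncomputable def innerC : Completion X →L⋆[ℂ] Completion X →L[ℂ] B :=
  ((X.innerL.flip.extend (Completion.toComplL : X →L[ℂ] Completion X)).flip).extend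
    (Completion.toComplL : X →L[ℂ] Completion X)

theorem rsmulC_coe (x : X) (b : B) :
    X.rsmulC (x : Completion X) b = ((X.rsmul x b : X) : Completion X) := by
  have h := ContinuousLinearMap.extend_eq (e := (Completion.toComplL : X →L[ℂ] Completion X))
    ((ContinuousLinearMap.compL ℂ B X (Completion X) Completion.toComplL).comp X.rsmulL)
    Completion.denseRange_coe (Completion.isUniformInducing_coe X) x
  exact congrArg (fun f => f b) h

theorem innerC_coe (x y : X) : X.innerC (x : Completion X) (y : Completion X) = X.inner x y := by
  have h := ContinuousLinearMap.extend_eq (e := (Completion.toComplL : X →L[ℂ] Completion X))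
    ((X.innerL.flip.extend (Completion.toComplL : X →L[ℂ] Completion X)).flip)
    Completion.denseRange_coe (Completion.isUniformInducing_coe X) x
  have h' := ContinuousLinearMap.extend_eq (e := (Completion.toComplL : X →L[ℂ] Completion X))
    X.innerL.flip Completion.denseRange_coe (Completion.isUniformInducing_coe X) y
  exact (congrArg (fun f => f (y : Completion X)) h).trans (congrArg (fun f => f x) h')

/-- The Hilbert module obtained from a semi-inner product module by dividing out the vectors of
length zero and completing. -/
noncomputable def completion : HilbertModule B where
  carrier := Completion X
  rsmul := (ContinuousLinearMap.coeLM ℂ).comp X.rsmulC.toLinearMap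
  inner := (ContinuousLinearMap.coeLM ℂ).comp X.innerC.toLinearMap
  rsmul_rsmul x a b := by
    change X.rsmulC (X.rsmulC x a) b = X.rsmulC x (a * b)
    induction x using Completion.induction_on with
    | hp => exact isClosed_eq (by fun_prop) (by fun_prop)
    | ih x => simp only [rsmulC_coe, X.rsmul_rsmul]
  inner_rsmul x y b := by
    change X.innerC x (X.rsmulC y b) = X.innerC x y * b
    induction x, y using Completion.induction_on₂ with
    | hp => exact isClosed_eq (by fun_prop) (by fun_prop)
    | ih x y => simp only [rsmulC_coe, innerC_coe, X.inner_rsmul]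
  star_inner x y := by
    change star (X.innerC x y) = X.innerC y x
    induction x, y using Completion.induction_on₂ with
    | hp => exact isClosed_eq (by fun_prop) (by fun_prop)
    | ih x y => simp only [innerC_coe, X.star_inner]
  inner_self x := by
    change X.innerC x x ∈ {z : B | ∃ b, z = star b * b}
    induction x using Completion.induction_on with
    | hp => exact (isClosed_setOf_exists_star_mul_self B).preimage (by fun_prop)
    | ih x => rw [innerC_coe]; exact X.inner_self x
  norm_sq x := by
    change ‖x‖ ^ 2 = ‖X.innerC x x‖
    induction x using Completion.induction_on with
    | hp => exact isClosed_eq (by fun_prop) (by fun_prop)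
    | ih x => rw [innerC_coe, Completion.norm_coe, X.norm_sq]

/-- The canonical map into the completion. -/
noncomputable def toCompletion : X →L[ℂ] X.completion := Completion.toComplL

theorem denseRange_toCompletion : DenseRange X.toCompletion := Completion.denseRange_coe

theorem inner_toCompletion (x y : X) :
    X.completion.inner (X.toCompletion x) (X.toCompletion y) = X.inner x y := X.innerC_coe x y

theorem rsmul_toCompletion (x : X) (b : B) :
    X.completion.rsmul (X.toCompletion x) b = X.toCompletion (X.rsmul x b) := X.rsmulC_coe x b

/-- A star-representation by adjointable maps is contractive. -/
theorem norm_act_le {A : Type*} [NonUnitalCStarAlgebra A] (ρ : A →ₙₐ[ℂ] Module.End ℂ X)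
    (hρ : ∀ a x y, X.inner (ρ a x) y = X.inner x (ρ (star a) y)) (a : A) (x : X) :
    ‖ρ a x‖ ≤ ‖a‖ * ‖x‖ := by
  let _ := CStarAlgebra.spectralOrder B
  let _ := CStarAlgebra.spectralOrderedRing B
  let _ := CStarAlgebra.spectralOrder (Unitization ℂ A)
  let _ := CStarAlgebra.spectralOrderedRing (Unitization ℂ A)
  have h := CStarAlgebra.star_mul_le_algebraMap_norm_sq (a := (a : Unitization ℂ A))
  obtain ⟨c, hc⟩ := CStarAlgebra.nonneg_iff_eq_star_mul_self.1 (sub_nonneg.2 h)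
  rw [Unitization.norm_inr] at hc
  let σ : Unitization ℂ A →ₐ[ℂ] Module.End ℂ X := Unitization.lift ρ
  have hσ : ∀ (z : ℂ) (b : A) (y : X),
      σ (Unitization.inl z + (b : Unitization ℂ A)) y = z • y + ρ b y := fun z b y => by
    simp [σ, Unitization.lift_apply]
  have hadj : ∀ (d : Unitization ℂ A) (y z : X), X.inner (σ d y) z = X.inner y (σ (star d) z) := by
    intro d y z
    induction d using Unitization.ind with
    | inl_add_inr r b =>
      rw [hσ, star_add, ← Unitization.inl_star, ← Unitization.inr_star, hσ]
      simp [hρ]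
  have e1 : X.inner (σ c x) (σ c x) = ((‖a‖ ^ 2 : ℝ) : ℂ) • X.inner x x
      - X.inner (ρ a x) (ρ a x) := by
    rw [hadj, ← Module.End.mul_apply, ← map_mul, ← hc, hρ, ← Module.End.mul_apply, ← map_mul]
    have e2 : algebraMap ℝ (Unitization ℂ A) (‖a‖ ^ 2) - star (a : Unitization ℂ A) * (a : Unitization ℂ A)
        = Unitization.inl (((‖a‖ ^ 2 : ℝ) : ℂ)) + ((-(star a * a) : A) : Unitization ℂ A) := by
      rw [Unitization.inr_neg, Unitization.inr_mul, Unitization.inr_star, sub_eq_add_neg]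
      congr 1
    rw [e2, hσ]
    simp only [map_add, map_neg, map_smul, LinearMap.neg_apply, sub_eq_add_neg]
  have h0 : 0 ≤ X.inner (σ c x) (σ c x) :=
    CStarAlgebra.nonneg_iff_eq_star_mul_self.2 (X.inner_self _)
  rw [e1] at h0
  have h3 := CStarAlgebra.norm_le_norm_of_nonneg_of_le
    (ha := CStarAlgebra.nonneg_iff_eq_star_mul_self.2 (X.inner_self (ρ a x))) (sub_nonneg.1 h0)
  refine le_of_sq_le_sq ?_ (mul_nonneg (norm_nonneg _) (norm_nonneg _))
  rw [mul_pow, norm_sq, norm_sq]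
  refine h3.trans ?_
  rw [norm_smul, Complex.norm_real, Real.norm_of_nonneg (by positivity)]

end PreHilbertModule

theorem exists_pos_sub_pos {M : Type*} [NonUnitalCStarAlgebra M] {g : M} (hg : IsSelfAdjoint g) :
    ∃ k m : M, g = star k * k - star m * m ∧ (star m * m) * (star k * k) = 0 := by
  let _ := CStarAlgebra.spectralOrder M
  let _ := CStarAlgebra.spectralOrderedRing M
  obtain ⟨k, hk⟩ := CStarAlgebra.nonneg_iff_eq_star_mul_self.1 (CFC.posPart_nonneg g)
  obtain ⟨m, hm⟩ := CStarAlgebra.nonneg_iff_eq_star_mul_self.1 (CFC.negPart_nonneg g)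
  refine ⟨k, m, ?_, ?_⟩
  · rw [← hk, ← hm, CFC.posPart_sub_negPart g hg]
  · rw [← hk, ← hm, CFC.negPart_mul_posPart]

namespace HilbertModule
variable {B : Type*} [NonUnitalCStarAlgebra B] (X : HilbertModule B)

theorem inner_rsmul_left (x y : X) (b : B) : X.inner (X.rsmul x b) y = star b * X.inner x y := by
  rw [← X.star_inner, X.inner_rsmul, star_mul, X.star_inner]

theorem rsmul_sum {ι : Type*} (s : Finset ι) (x : X) (b : ι → B) :
    X.rsmul x (∑ i ∈ s, b i) = ∑ i ∈ s, X.rsmul x (b i) := map_sum _ _ _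

/-- The Gram matrix of finitely many vectors is positive. -/
theorem exists_gram_eq {n : Type*} [Fintype n] (x : n → X) :
    ∃ K : n → n → B, ∀ i j, X.inner (x i) (x j) = ∑ k, star (K k i) * K k j := by
  let _ := CStarAlgebra.spectralOrder B
  let _ := CStarAlgebra.spectralOrderedRing B
  set G : CStarMatrix n n B := CStarMatrix.ofMatrix fun i j => X.inner (x i) (x j) with hG
  have hGs : IsSelfAdjoint G := by
    ext i j
    rw [CStarMatrix.star_apply]
    exact X.star_inner (x j) (x i)
  obtain ⟨K, m, hKm, hmK⟩ := exists_pos_sub_pos hGs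
  obtain ⟨N, hm⟩ : ∃ N, N = star m * m := ⟨_, rfl⟩
  rw [← hm] at hKm hmK
  have hNs : star N = N := by rw [hm]; simp
  have hGN : N * G = -(N * N) := by
    rw [hKm, mul_sub, hmK, zero_sub]
  set h := m * N with hh
  have hNNN : N * N * N = star h * h := by
    rw [hh, star_mul, hNs]
    nth_rewrite 2 [hm]
    simp only [mul_assoc]
  have hsum : N * G * N + star h * h = 0 := by
    rw [hGN, ← hNNN]; simp
  have hzero : h = 0 := by
    ext k i
    have hd := congrFun (congrFun hsum i) i
    have e1 : (N * G * N) i i = X.inner (∑ k, X.rsmul (x k) (N k i)) (∑ k, X.rsmul (x k) (N k i)) := by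
      simp only [CStarMatrix.mul_apply, map_sum, LinearMap.sum_apply, X.inner_rsmul,
        X.inner_rsmul_left, Finset.sum_mul]
      refine Finset.sum_congr rfl fun k _ => Finset.sum_congr rfl fun j _ => ?_
      rw [← CStarMatrix.star_apply, hNs]
      rfl
    have e2 : (star h * h) i i = ∑ k, star (h k i) * h k i := by
      simp only [CStarMatrix.mul_apply, CStarMatrix.star_apply]
    have e3 : 0 ≤ (N * G * N) i i := by
      rw [e1]; exact CStarAlgebra.nonneg_iff_eq_star_mul_self.2 (X.inner_self _)
    have e4 : ∀ k ∈ Finset.univ, 0 ≤ star (h k i) * h k i := fun k _ => star_mul_self_nonneg _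
    have e5 : ∑ k, star (h k i) * h k i = 0 := by
      refine le_antisymm ?_ (Finset.sum_nonneg e4)
      have : (N * G * N) i i + ∑ k, star (h k i) * h k i = 0 := by rw [← e2]; exact hd
      rw [← this]
      exact le_add_of_nonneg_left e3
    exact CStarRing.star_mul_self_eq_zero_iff _ |>.1
      ((Finset.sum_eq_zero_iff_of_nonneg e4).1 e5 k (Finset.mem_univ k))
  have hNNN0 : N * N * N = 0 := by rw [hNNN, hzero]; simp
  have hNN : N * N = 0 := by
    rw [← CStarRing.star_mul_self_eq_zero_iff, star_mul, hNs, ← mul_assoc, hNNN0, zero_mul]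
  have hN' : N = 0 := by
    rw [← CStarRing.star_mul_self_eq_zero_iff, hNs, hNN]
  rw [hN', sub_zero] at hKm
  refine ⟨fun i j => K i j, fun i j => ?_⟩
  have := congrFun (congrFun hKm i) j
  rw [CStarMatrix.mul_apply] at this
  simp only [CStarMatrix.star_apply] at this
  exact this

end HilbertModule

/-- A nondegenerate left action of `A` on a Hilbert `B`-module by adjointable operators. The
operator `act a` has the adjoint `act (star a)`, and the vectors `a · x` span a dense subspace. -/
structure LeftAction (A : Type*) [NonUnitalCStarAlgebra A] {B : Type*} [NonUnitalCStarAlgebra B]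
    (X : HilbertModule B) where
  act : A →ₙₐ[ℂ] (X →L[ℂ] X)
  inner_act : ∀ a x y, X.inner (act a x) y = X.inner x (act (star a) y)
  nondegenerate : Dense (Submodule.span ℂ {z : X | ∃ a x, z = act a x} : Set X)

/-- A correspondence from `A` to `B`: a Hilbert `B`-module with a nondegenerate left action of `A`
by adjointable operators. -/
structure Correspondence.{v, u₁, u₂} (A : Type u₁) (B : Type u₂) [NonUnitalCStarAlgebra A]
    [NonUnitalCStarAlgebra B] where
  toHilbertModule : HilbertModule.{v} B
  left : LeftAction A toHilbertModule

namespace Correspondence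

variable {A B C : Type*} [NonUnitalCStarAlgebra A] [NonUnitalCStarAlgebra B]
  [NonUnitalCStarAlgebra C]

instance : CoeSort (Correspondence A B) (Type _) := ⟨fun X => X.toHilbertModule.carrier⟩

abbrev act (X : Correspondence A B) : A →ₙₐ[ℂ] (X →L[ℂ] X) := X.left.act
abbrev inner (X : Correspondence A B) : X →ₗ⋆[ℂ] X →ₗ[ℂ] B := X.toHilbertModule.inner
abbrev rsmul (X : Correspondence A B) : X →ₗ[ℂ] B →ₗ[ℂ] X := X.toHilbertModule.rsmul

end Correspondence

namespace HilbertModule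

variable {A B C : Type*} [NonUnitalCStarAlgebra A] [NonUnitalCStarAlgebra B]
  [NonUnitalCStarAlgebra C] (X : HilbertModule B) (Y : Correspondence B C)

/-- The form `⟨x ⊗ y, x' ⊗ y'⟩ = ⟨y, ⟨x, x'⟩ · y'⟩` on the algebraic tensor product. -/
noncomputable def tensorInner : (X ⊗[ℂ] Y) →ₗ⋆[ℂ] (X ⊗[ℂ] Y) →ₗ[ℂ] C :=
  TensorProduct.lift <| LinearMap.mk₂'ₛₗ (starRingEnd ℂ) (starRingEnd ℂ)
    (fun x y => TensorProduct.lift <| LinearMap.mk₂ ℂ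
      (fun x' y' => Y.inner y (Y.act (X.inner x x') y'))
      (by intros; simp) (by intros; simp) (by intros; simp) (by intros; simp))
    (by intros; ext; simp) (by intros; ext; simp)
    (by intros; ext; simp) (by intros; ext; simp)

theorem tensorInner_tmul (x x' : X) (y y' : Y) :
    X.tensorInner Y (x ⊗ₜ y) (x' ⊗ₜ y') = Y.inner y (Y.act (X.inner x x') y') := rfl

/-- The algebraic tensor product over `ℂ` with this form. -/
noncomputable def preTensor : PreHilbertModule C where
  carrier := X ⊗[ℂ] Y
  rsmul := (LinearMap.lTensorHom X).comp Y.rsmul.flip |>.flip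
  inner := X.tensorInner Y
  rsmul_rsmul t a b := by
    induction t using TensorProduct.induction_on with
    | zero => simp
    | tmul x y => simp [Y.toHilbertModule.rsmul_rsmul]
    | add s t hs ht => simp only [map_add, LinearMap.add_apply, hs, ht]
  inner_rsmul s t b := by
    induction t using TensorProduct.induction_on with
    | zero => simp
    | tmul x y =>
      induction s using TensorProduct.induction_on with
      | zero => simp
      | tmul x' y' =>
        change X.tensorInner Y (x' ⊗ₜ y') (x ⊗ₜ Y.rsmul y b) = _
        rw [tensorInner_tmul, tensorInner_tmul, ← star_star (X.inner x' x), ← Y.left.inner_act,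
          Y.toHilbertModule.inner_rsmul, ← Y.left.inner_act]
      | add s t hs ht => simp only [map_add, LinearMap.add_apply, hs, ht, add_mul]
    | add s t hs ht => simp only [map_add, LinearMap.add_apply, hs, ht, add_mul]
  star_inner s t := by
    induction t using TensorProduct.induction_on with
    | zero => simp
    | tmul x y =>
      induction s using TensorProduct.induction_on with
      | zero => simp
      | tmul x' y' =>
        rw [tensorInner_tmul, tensorInner_tmul, Y.toHilbertModule.star_inner, Y.left.inner_act,
          X.star_inner]
      | add s t hs ht => simp only [map_add, LinearMap.add_apply, hs, ht, star_add]
    | add s t hs ht => simp only [map_add, LinearMap.add_apply, hs, ht, star_add]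
  inner_self t := by
    let _ := CStarAlgebra.spectralOrder C
    let _ := CStarAlgebra.spectralOrderedRing C
    obtain ⟨S, rfl⟩ := TensorProduct.exists_finset t
    obtain ⟨K, hK⟩ := X.exists_gram_eq (fun i : S => i.1.1)
    rw [← CStarAlgebra.nonneg_iff_eq_star_mul_self]
    have e : X.tensorInner Y (∑ i ∈ S, i.1 ⊗ₜ i.2) (∑ i ∈ S, i.1 ⊗ₜ i.2)
        = ∑ k : S, Y.inner (∑ i : S, Y.act (K k i) i.1.2) (∑ i : S, Y.act (K k i) i.1.2) := by
      rw [← Finset.sum_coe_sort S]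
      simp only [map_sum, LinearMap.sum_apply, tensorInner_tmul, hK, _root_.sum_apply,
        Y.left.inner_act]
      rw [Finset.sum_comm' (t' := Finset.univ) (s' := fun _ => Finset.univ) (by simp)]
      simp only [map_mul, mul_apply_eq_comp]
      rw [Finset.sum_comm]
      conv_rhs => rw [Finset.sum_comm]
      refine Finset.sum_congr rfl fun i _ => ?_
      conv_rhs => rw [Finset.sum_comm]
    rw [e]
    exact Finset.sum_nonneg fun k _ =>
      CStarAlgebra.nonneg_iff_eq_star_mul_self.2 (Y.toHilbertModule.inner_self _)

end HilbertModule

namespace PreHilbertModule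

variable {A B : Type*} [NonUnitalCStarAlgebra A] [NonUnitalCStarAlgebra B] (X : PreHilbertModule B)
  (ρ : A →ₙₐ[ℂ] Module.End ℂ X)
  (hρ : ∀ a x y, X.inner (ρ a x) y = X.inner x (ρ (star a) y))

/-- Extension of a bounded operator to the completion. -/
noncomputable def completionActAux (a : A) : X.completion →L[ℂ] X.completion :=
  (X.toCompletion.comp ((ρ a).mkContinuous ‖a‖ (X.norm_act_le ρ hρ a))).extend X.toCompletion

theorem completionActAux_toCompletion (a : A) (x : X) :
    X.completionActAux ρ hρ a (X.toCompletion x) = X.toCompletion (ρ a x) :=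
  ContinuousLinearMap.extend_eq (e := X.toCompletion)
    (X.toCompletion.comp ((ρ a).mkContinuous ‖a‖ (X.norm_act_le ρ hρ a)))
    X.denseRange_toCompletion (UniformSpace.Completion.isUniformInducing_coe X) x

theorem completion_ext {f g : X.completion →L[ℂ] X.completion}
    (h : ∀ x, f (X.toCompletion x) = g (X.toCompletion x)) : f = g :=
  ContinuousLinearMap.coeFn_injective <|
    X.denseRange_toCompletion.equalizer f.continuous g.continuous (funext h)

/-- Extension of a star-representation to the completion. -/
noncomputable def completionAct : A →ₙₐ[ℂ] (X.completion →L[ℂ] X.completion) where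
  toFun := X.completionActAux ρ hρ
  map_smul' z a := X.completion_ext fun x => by
    simp [completionActAux_toCompletion]
  map_zero' := X.completion_ext fun x => by
    simp [completionActAux_toCompletion]
  map_add' a b := X.completion_ext fun x => by
    simp [completionActAux_toCompletion]
  map_mul' a b := X.completion_ext fun x => by
    simp [completionActAux_toCompletion]

theorem completionAct_toCompletion (a : A) (x : X) :
    X.completionAct ρ hρ a (X.toCompletion x) = X.toCompletion (ρ a x) :=
  X.completionActAux_toCompletion ρ hρ a x

theorem inner_completionAct (a : A) (x y : X.completion) :
    X.completion.inner (X.completionAct ρ hρ a x) y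
      = X.completion.inner x (X.completionAct ρ hρ (star a) y) := by
  have hc : Continuous fun p : X.completion × X.completion => X.completion.inner p.1 p.2 := by
    have h : Continuous fun p : UniformSpace.Completion X × UniformSpace.Completion X =>
      X.innerC p.1 p.2 := by fun_prop
    exact h
  have h : (fun p : X.completion × X.completion =>
      X.completion.inner (X.completionAct ρ hρ a p.1) p.2)
      = fun p => X.completion.inner p.1 (X.completionAct ρ hρ (star a) p.2) := by
    refine (X.denseRange_toCompletion.prodMap X.denseRange_toCompletion).equalizer
      ?_ ?_ (funext fun p => ?_)
    · exact hc.comp (((X.completionAct ρ hρ a).continuous.comp continuous_fst).prodMk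
        continuous_snd)
    · exact hc.comp (continuous_fst.prodMk
        ((X.completionAct ρ hρ (star a)).continuous.comp continuous_snd))
    · simp only [Function.comp_apply, Prod.map, completionAct_toCompletion]
      exact (X.inner_toCompletion _ _).trans ((hρ _ _ _).trans (X.inner_toCompletion _ _).symm)
  exact congrFun h (x, y)

end PreHilbertModule

/-- A Hilbert module is a semi-inner product module. -/
def HilbertModule.toPre {B : Type*} [NonUnitalCStarAlgebra B] (X : HilbertModule B) :
    PreHilbertModule B where
  carrier := X
  rsmul := X.rsmul
  inner := X.inner
  rsmul_rsmul := X.rsmul_rsmul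
  inner_rsmul := X.inner_rsmul
  star_inner := X.star_inner
  inner_self := X.inner_self

theorem HilbertModule.norm_eq {B : Type*} [NonUnitalCStarAlgebra B] (X : HilbertModule B) (x : X) :
    ‖x‖ = √‖X.inner x x‖ := by
  rw [← X.norm_sq, Real.sqrt_sq (norm_nonneg _)]

theorem HilbertModule.norm_inner_le {B : Type*} [NonUnitalCStarAlgebra B] (X : HilbertModule B)
    (x y : X) : ‖X.inner x y‖ ≤ ‖x‖ * ‖y‖ := by
  rw [X.norm_eq, X.norm_eq]
  exact X.toPre.norm_inner_le x y

theorem LeftAction.norm_act_le {A B : Type*} [NonUnitalCStarAlgebra A] [NonUnitalCStarAlgebra B]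
    {X : HilbertModule B} (L : LeftAction A X) (a : A) (x : X) : ‖L.act a x‖ ≤ ‖a‖ * ‖x‖ := by
  rw [X.norm_eq, X.norm_eq]
  let ρ : A →ₙₐ[ℂ] Module.End ℂ X :=
    { toFun := fun a => (L.act a).toLinearMap
      map_smul' := fun z a => by ext; simp
      map_zero' := by ext; simp
      map_add' := fun a b => by ext; simp
      map_mul' := fun a b => by ext; simp }
  exact X.toPre.norm_act_le ρ L.inner_act a x

namespace HilbertModule

variable {A B C : Type*} [NonUnitalCStarAlgebra A] [NonUnitalCStarAlgebra B]
  [NonUnitalCStarAlgebra C] (X : HilbertModule B) (Y : Correspondence B C)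

/-- The interior tensor product `X ⊗_B Y`: divide the algebraic tensor product by the vectors of
length zero (among them all `x · b ⊗ y - x ⊗ b · y`) and complete. -/
noncomputable def tensor : HilbertModule C := (X.preTensor Y).completion

/-- The elementary tensor `x ⊗ y`. -/
noncomputable def tmul (x : X) (y : Y) : X.tensor Y :=
  (X.preTensor Y).toCompletion (x ⊗ₜ[ℂ] y : X ⊗[ℂ] Y)

theorem inner_tmul (x x' : X) (y y' : Y) :
    (X.tensor Y).inner (X.tmul Y x y) (X.tmul Y x' y') = Y.inner y (Y.act (X.inner x x') y') :=
  (X.preTensor Y).inner_toCompletion _ _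

theorem norm_tmul_le (x : X) (y : Y) : ‖X.tmul Y x y‖ ≤ ‖x‖ * ‖y‖ := by
  refine le_of_sq_le_sq ?_ (mul_nonneg (norm_nonneg _) (norm_nonneg _))
  rw [(X.tensor Y).norm_sq, inner_tmul, mul_pow, X.norm_sq]
  refine (Y.toHilbertModule.norm_inner_le _ _).trans ?_
  calc _ ≤ ‖y‖ * (‖X.inner x x‖ * ‖y‖) := by gcongr; exact Y.left.norm_act_le _ _
    _ = _ := by ring

/-- The canonical bilinear map `(x, y) ↦ x ⊗ y`. -/
noncomputable def tmulL : X →L[ℂ] Y →L[ℂ] X.tensor Y :=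
  ((TensorProduct.mk ℂ X Y).compr₂ (X.preTensor Y).toCompletion.toLinearMap).mkContinuous₂ 1
    fun x y => by rw [one_mul]; exact X.norm_tmul_le Y x y

theorem tmulL_apply (x : X) (y : Y) : X.tmulL Y x y = X.tmul Y x y := rfl

theorem rsmul_tmul (x : X) (y : Y) (c : C) :
    (X.tensor Y).rsmul (X.tmul Y x y) c = X.tmul Y x (Y.rsmul y c) :=
  (X.preTensor Y).rsmul_toCompletion _ _

theorem dense_span_tmul :
    Dense (Submodule.span ℂ {t : X.tensor Y | ∃ x y, t = X.tmul Y x y} : Set (X.tensor Y)) := by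
  let S := Submodule.span ℂ {t : X.tensor Y | ∃ x y, t = X.tmul Y x y}
  refine (X.preTensor Y).denseRange_toCompletion.mono (?_ : _ ⊆ (S : Set (X.tensor Y)))
  rintro _ ⟨t, rfl⟩
  change X ⊗[ℂ] Y at t
  induction t using TensorProduct.induction_on with
  | zero =>
    have h : (X.preTensor Y).toCompletion (0 : X.preTensor Y) = 0 :=
      (X.preTensor Y).toCompletion.map_zero
    exact Set.mem_of_eq_of_mem h S.zero_mem
  | tmul x y => exact Submodule.subset_span ⟨x, y, rfl⟩
  | add s t hs ht =>
    have h : (X.preTensor Y).toCompletion ((s : X.preTensor Y) + (t : X.preTensor Y))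
        = (X.preTensor Y).toCompletion s + (X.preTensor Y).toCompletion t :=
      (X.preTensor Y).toCompletion.map_add _ _
    exact Set.mem_of_eq_of_mem h (S.add_mem hs ht)

end HilbertModule

namespace Correspondence

variable {A B C : Type*} [NonUnitalCStarAlgebra A] [NonUnitalCStarAlgebra B]
  [NonUnitalCStarAlgebra C] (X : Correspondence A B) (Y : Correspondence B C)

/-- The left action `a · (x ⊗ y) = (a · x) ⊗ y`. -/
noncomputable def preTensorAct : A →ₙₐ[ℂ] Module.End ℂ (X.toHilbertModule.preTensor Y) where
  toFun a := (X.act a).toLinearMap.rTensor Y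
  map_smul' z a := TensorProduct.ext' fun x y => by
    change X.act (z • a) x ⊗ₜ[ℂ] y = z • (X.act a x ⊗ₜ[ℂ] y)
    rw [map_smul, smul_apply, TensorProduct.smul_tmul']
  map_zero' := TensorProduct.ext' fun x y => by
    change X.act 0 x ⊗ₜ[ℂ] y = 0
    rw [map_zero, zero_apply, TensorProduct.zero_tmul]
  map_add' a b := TensorProduct.ext' fun x y => by
    change X.act (a + b) x ⊗ₜ[ℂ] y = X.act a x ⊗ₜ[ℂ] y + X.act b x ⊗ₜ[ℂ] y
    rw [map_add, add_apply, TensorProduct.add_tmul]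
  map_mul' a b := TensorProduct.ext' fun x y => by
    change X.act (a * b) x ⊗ₜ[ℂ] y = X.act a (X.act b x) ⊗ₜ[ℂ] y
    rw [map_mul, mul_apply_eq_comp]

theorem inner_preTensorAct (a : A) (s t : X.toHilbertModule.preTensor Y) :
    (X.toHilbertModule.preTensor Y).inner (X.preTensorAct Y a s) t
      = (X.toHilbertModule.preTensor Y).inner s (X.preTensorAct Y (star a) t) := by
  change X ⊗[ℂ] Y at s t
  change X.toHilbertModule.tensorInner Y ((X.act a).toLinearMap.rTensor Y s) t
    = X.toHilbertModule.tensorInner Y s ((X.act (star a)).toLinearMap.rTensor Y t)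
  induction t using TensorProduct.induction_on with
  | zero => simp
  | tmul x y =>
    induction s using TensorProduct.induction_on with
    | zero => simp
    | tmul x' y' =>
      simp only [LinearMap.rTensor_tmul, HilbertModule.tensorInner_tmul]
      congr 3
      exact X.left.inner_act a x' x
    | add s t hs ht => simp only [map_add, LinearMap.add_apply, hs, ht]
  | add s t hs ht => simp only [map_add, hs, ht]

/-- The interior tensor product `X ⊗_B Y` of correspondences. -/
noncomputable def tensor : Correspondence A C where
  toHilbertModule := X.toHilbertModule.tensor Y
  left :=
    { act := (X.toHilbertModule.preTensor Y).completionAct (X.preTensorAct Y)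
        (X.inner_preTensorAct Y)
      inner_act := (X.toHilbertModule.preTensor Y).inner_completionAct (X.preTensorAct Y)
        (X.inner_preTensorAct Y)
      nondegenerate := by
        have hd : Dense (Submodule.span ℂ {t : X.toHilbertModule.tensor Y |
          ∃ x y, t = X.toHilbertModule.tmul Y x y} : Set (X.toHilbertModule.tensor Y)) :=
          X.toHilbertModule.dense_span_tmul Y
        rw [Submodule.dense_iff_topologicalClosure_eq_top] at hd ⊢
        rw [eq_top_iff, ← hd]
        refine Submodule.topologicalClosure_minimal _ (Submodule.span_le.2 ?_)
          (Submodule.isClosed_topologicalClosure _)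
        rintro _ ⟨x, y, rfl⟩
        let f : X.toHilbertModule →L[ℂ] X.toHilbertModule.tensor Y :=
          (X.toHilbertModule.tmulL Y).flip y
        have hx : x ∈ closure (Submodule.span ℂ {z : X | ∃ a x, z = X.act a x} : Set X) :=
          X.left.nondegenerate x
        change f x ∈ closure _
        refine map_mem_closure f.continuous hx fun z hz => ?_
        have : Submodule.span ℂ {z : X | ∃ a x, z = X.act a x} ≤ Submodule.comap f.toLinearMap
            (Submodule.span ℂ {z : X.toHilbertModule.tensor Y | ∃ a t, z =
              (X.toHilbertModule.preTensor Y).completionAct (X.preTensorAct Y)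
                (X.inner_preTensorAct Y) a t}) := by
          refine Submodule.span_le.2 ?_
          rintro _ ⟨a, w, rfl⟩
          refine Submodule.subset_span ⟨a, X.toHilbertModule.tmul Y w y, ?_⟩
          exact ((X.toHilbertModule.preTensor Y).completionAct_toCompletion (X.preTensorAct Y)
            (X.inner_preTensorAct Y) a (w ⊗ₜ[ℂ] y : X ⊗[ℂ] Y)).symm
        exact this hz }

/-- The elementary tensor `x ⊗ y`. -/
noncomputable abbrev tmul (x : X) (y : Y) : X.tensor Y :=
  X.toHilbertModule.tmul Y x y

theorem dense_span_tmul :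
    Dense (Submodule.span ℂ {t : X.tensor Y | ∃ x y, t = X.tmul Y x y} : Set (X.tensor Y)) :=
  X.toHilbertModule.dense_span_tmul Y

theorem act_tmul (a : A) (x : X) (y : Y) :
    (X.tensor Y).act a (X.tmul Y x y) = X.tmul Y (X.act a x) y :=
  (X.toHilbertModule.preTensor Y).completionAct_toCompletion (X.preTensorAct Y)
    (X.inner_preTensorAct Y) a (x ⊗ₜ[ℂ] y : X ⊗[ℂ] Y)

end Correspondence

/-- A closed two-sided self-adjoint ideal of a C⋆-algebra. -/
structure ClosedIdeal (A : Type*) [NonUnitalCStarAlgebra A] extends Submodule ℂ A where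
  mul_mem_left : ∀ a b, b ∈ carrier → a * b ∈ carrier
  mul_mem_right : ∀ a b, a ∈ carrier → a * b ∈ carrier
  star_mem : ∀ a, a ∈ carrier → star a ∈ carrier
  isClosed : IsClosed carrier

namespace ClosedIdeal

variable {A : Type*} [NonUnitalCStarAlgebra A] (I : ClosedIdeal A)

/-- The ideal as a C⋆-subalgebra. -/
def toSubalgebra : NonUnitalStarSubalgebra ℂ A where
  __ := I.toSubmodule
  mul_mem' {a b} _ hb := I.mul_mem_left a b hb
  star_mem' {a} ha := I.star_mem a ha

theorem exists_approx (i : A) (hi : i ∈ I.toSubmodule) {ε : ℝ} (hε : 0 < ε) :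
    ∃ e ∈ I.toSubmodule, star e = e ∧ (∀ z, ‖z - e * z‖ ≤ ‖z‖) ∧ ‖i - e * i‖ < ε := by
  let _ := CStarAlgebra.spectralOrder A
  let _ := CStarAlgebra.spectralOrderedRing A
  have _ : IsClosed (I.toSubalgebra : Set A) := I.isClosed
  let _ := CStarAlgebra.spectralOrder I.toSubalgebra
  let _ := CStarAlgebra.spectralOrderedRing I.toSubalgebra
  have h := CStarAlgebra.increasingApproximateUnit I.toSubalgebra
  let i' : I.toSubalgebra := ⟨i, hi⟩
  have h1 := (Metric.tendsto_nhds.1 (h.tendsto_mul_right i')) ε hε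
  obtain ⟨e, he1, he2, he3⟩ := (h1.and (h.eventually_nonneg.and h.eventually_norm)).exists
  have he0 : (0 : A) ≤ e := by
    obtain ⟨b, hb⟩ := CStarAlgebra.nonneg_iff_eq_star_mul_self.1 he2
    refine CStarAlgebra.nonneg_iff_eq_star_mul_self.2 ⟨b, ?_⟩
    rw [hb]; rfl
  refine ⟨e, e.2, (IsSelfAdjoint.of_nonneg he0).star_eq, fun z => ?_, ?_⟩
  · refine CStarAlgebra.norm_sub_mul_self_le_of_inr z le_rfl he0 he3 (norm_nonneg _) ?_
    rw [Unitization.inr_zero, sub_zero, mul_one, CStarRing.norm_star_mul_self, Unitization.norm_inr,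
      sq]
  · rw [dist_comm, dist_eq_norm] at he1
    exact he1

/-- The quotient C⋆-algebra `A ⧸ I`, with the quotient norm. -/
def Quotient : Type _ := A ⧸ I.toSubmodule

instance : IsClosed (I.toSubmodule : Set A) := I.isClosed

noncomputable instance : NormedAddCommGroup I.Quotient :=
  Submodule.Quotient.normedAddCommGroup I.toSubmodule

noncomputable instance : NormedSpace ℂ I.Quotient :=
  Submodule.Quotient.normedSpace I.toSubmodule ℂ

instance : CompleteSpace I.Quotient := Submodule.Quotient.completeSpace I.toSubmodule

/-- The quotient map as a linear map. -/
def mkL : A →ₗ[ℂ] I.Quotient := I.toSubmodule.mkQ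

theorem mkL_surjective : Function.Surjective I.mkL := I.toSubmodule.mkQ_surjective

theorem mkL_eq_iff {a b : A} : I.mkL a = I.mkL b ↔ a - b ∈ I.toSubmodule :=
  Submodule.Quotient.eq I.toSubmodule

theorem norm_mkL_le (a : A) : ‖I.mkL a‖ ≤ ‖a‖ := Submodule.Quotient.norm_mk_le I.toSubmodule a

theorem exists_mkL_eq (x : I.Quotient) {ε : ℝ} (hε : 0 < ε) : ∃ a, I.mkL a = x ∧ ‖a‖ < ‖x‖ + ε :=
  Submodule.Quotient.norm_mk_lt (S := I.toSubmodule) x hε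

noncomputable instance : Mul I.Quotient where
  mul := Quotient.map₂ (· * ·) fun a a' ha b b' hb => by
    have ha' : a - a' ∈ I.toSubmodule := (Submodule.quotientRel_def _).1 ha
    have hb' : b - b' ∈ I.toSubmodule := (Submodule.quotientRel_def _).1 hb
    refine (Submodule.quotientRel_def _).2 ?_
    have : a * b - a' * b' = (a - a') * b + a' * (b - b') := by noncomm_ring
    rw [this]
    exact Submodule.add_mem _ (I.mul_mem_right _ _ ha') (I.mul_mem_left _ _ hb')

noncomputable instance : Star I.Quotient where
  star := Quotient.map star fun a a' ha => by
    have ha' : a - a' ∈ I.toSubmodule := (Submodule.quotientRel_def _).1 ha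
    refine (Submodule.quotientRel_def _).2 ?_
    rw [← star_sub]
    exact I.star_mem _ ha'

theorem mkL_mul (a b : A) : I.mkL (a * b) = I.mkL a * I.mkL b := rfl
theorem mkL_star (a : A) : I.mkL (star a) = star (I.mkL a) := rfl

noncomputable instance : NonUnitalNormedRing I.Quotient where
  __ := (inferInstance : NormedAddCommGroup I.Quotient)
  left_distrib x y z := by
    obtain ⟨a, rfl⟩ := I.mkL_surjective x
    obtain ⟨b, rfl⟩ := I.mkL_surjective y
    obtain ⟨c, rfl⟩ := I.mkL_surjective z
    simp only [← map_add, ← mkL_mul, mul_add]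
  right_distrib x y z := by
    obtain ⟨a, rfl⟩ := I.mkL_surjective x
    obtain ⟨b, rfl⟩ := I.mkL_surjective y
    obtain ⟨c, rfl⟩ := I.mkL_surjective z
    simp only [← map_add, ← mkL_mul, add_mul]
  zero_mul x := by
    obtain ⟨a, rfl⟩ := I.mkL_surjective x
    rw [← map_zero I.mkL, ← mkL_mul, zero_mul]
  mul_zero x := by
    obtain ⟨a, rfl⟩ := I.mkL_surjective x
    rw [← map_zero I.mkL, ← mkL_mul, mul_zero]
  mul_assoc x y z := by
    obtain ⟨a, rfl⟩ := I.mkL_surjective x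
    obtain ⟨b, rfl⟩ := I.mkL_surjective y
    obtain ⟨c, rfl⟩ := I.mkL_surjective z
    simp only [← mkL_mul, mul_assoc]
  norm_mul_le x y := by
    refine le_of_forall_pos_le_add fun ε hε => ?_
    have h : Filter.Tendsto (fun δ : ℝ => (‖x‖ + δ) * (‖y‖ + δ)) (nhdsWithin 0 (Set.Ioi 0))
        (nhds (‖x‖ * ‖y‖)) := by
      have : Filter.Tendsto (fun δ : ℝ => (‖x‖ + δ) * (‖y‖ + δ)) (nhds 0)
          (nhds ((‖x‖ + 0) * (‖y‖ + 0))) := Continuous.tendsto (by fun_prop) 0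
      simp only [add_zero] at this
      exact this.mono_left nhdsWithin_le_nhds
    obtain ⟨δ, hδ, hpos⟩ := ((h.eventually_lt_const (lt_add_of_pos_right _ hε)).and
      self_mem_nhdsWithin).exists
    obtain ⟨a, rfl, ha⟩ := I.exists_mkL_eq x hpos
    obtain ⟨b, rfl, hb⟩ := I.exists_mkL_eq y hpos
    rw [← mkL_mul]
    calc _ ≤ ‖a‖ * ‖b‖ := (I.norm_mkL_le _).trans (norm_mul_le a b)
      _ ≤ (‖I.mkL a‖ + δ) * (‖I.mkL b‖ + δ) := by gcongr
      _ ≤ _ := hδ.le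

noncomputable instance : StarRing I.Quotient where
  star_involutive x := by
    obtain ⟨a, rfl⟩ := I.mkL_surjective x
    simp only [← mkL_star, star_star]
  star_mul x y := by
    obtain ⟨a, rfl⟩ := I.mkL_surjective x
    obtain ⟨b, rfl⟩ := I.mkL_surjective y
    simp only [← mkL_star, ← mkL_mul, star_mul]
  star_add x y := by
    obtain ⟨a, rfl⟩ := I.mkL_surjective x
    obtain ⟨b, rfl⟩ := I.mkL_surjective y
    simp only [← mkL_star, ← map_add, star_add]

noncomputable instance : NonUnitalCStarAlgebra I.Quotient where
  norm_mul_self_le x := by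
    obtain ⟨a, rfl⟩ := I.mkL_surjective x
    rw [← mkL_star, ← mkL_mul]
    refine le_of_forall_pos_le_add fun ε hε => ?_
    obtain ⟨b, hb, hb'⟩ := I.exists_mkL_eq (I.mkL (star a * a)) (half_pos hε)
    have hi := I.mkL_eq_iff.1 hb
    obtain ⟨e, heI, hes, hec, hei⟩ := I.exists_approx _ hi (half_pos hε)
    have h1 : ‖I.mkL a‖ ≤ ‖a - a * e‖ := by
      have : I.mkL a = I.mkL (a - a * e) := by
        rw [I.mkL_eq_iff, sub_sub_cancel]; exact I.mul_mem_left _ _ heI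
      rw [this]; exact I.norm_mkL_le _
    set z := star a * a - e * (star a * a) with hz
    have h2 : star (a - a * e) * (a - a * e) = z - z * e := by
      rw [star_sub, star_mul, hes, hz]; noncomm_ring
    have h3 : ‖z - z * e‖ ≤ ‖z‖ := by
      have := hec (star z)
      rwa [norm_star, ← norm_star (star z - e * star z), star_sub, star_mul, star_star, hes] at this
    have h4 : z = (b - e * b) - ((b - star a * a) - e * (b - star a * a)) := by
      rw [hz]; noncomm_ring
    calc ‖I.mkL a‖ * ‖I.mkL a‖ ≤ ‖a - a * e‖ * ‖a - a * e‖ := by gcongr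
      _ = ‖z - z * e‖ := by rw [← CStarRing.norm_star_mul_self, h2]
      _ ≤ ‖z‖ := h3
      _ ≤ ‖b‖ + ε / 2 := by
        rw [h4]
        exact (norm_sub_le _ _).trans (add_le_add (hec b) hei.le)
      _ ≤ _ := by linarith
  smul_assoc z x y := by
    obtain ⟨a, rfl⟩ := I.mkL_surjective x
    obtain ⟨b, rfl⟩ := I.mkL_surjective y
    simp only [smul_eq_mul, ← mkL_mul, ← map_smul, smul_mul_assoc]
  smul_comm z x y := by
    obtain ⟨a, rfl⟩ := I.mkL_surjective x
    obtain ⟨b, rfl⟩ := I.mkL_surjective y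
    simp only [smul_eq_mul, ← mkL_mul, ← map_smul, mul_smul_comm]
  star_smul z x := by
    obtain ⟨a, rfl⟩ := I.mkL_surjective x
    simp only [← mkL_star, ← map_smul, star_smul]

/-- The quotient map `A → A ⧸ I`. -/
noncomputable def proj : A →⋆ₙₐ[ℂ] I.Quotient where
  __ := I.mkL
  map_zero' := map_zero I.mkL
  map_mul' := I.mkL_mul
  map_star' := I.mkL_star

theorem proj_surjective : Function.Surjective I.proj := I.mkL_surjective

theorem proj_eq_zero_iff (a : A) : I.proj a = 0 ↔ a ∈ I.toSubmodule :=
  Submodule.Quotient.mk_eq_zero I.toSubmodule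

end ClosedIdeal

namespace HilbertModule

variable {B : Type*} [NonUnitalCStarAlgebra B] (X : HilbertModule B)

theorem norm_rsmul_le (x : X) (b : B) : ‖X.rsmul x b‖ ≤ ‖x‖ * ‖b‖ := by
  rw [X.norm_eq, X.norm_eq]
  exact X.toPre.norm_rsmul_le x b

/-- The operator `|x⟩⟨y|`, that is, `z ↦ x · ⟨y, z⟩`. -/
noncomputable def rankOne (x y : X) : X →L[ℂ] X :=
  ((X.rsmul x).comp (X.inner y)).mkContinuous (‖x‖ * ‖y‖) fun z => by
    refine (X.norm_rsmul_le _ _).trans ?_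
    rw [mul_assoc]
    gcongr
    exact X.norm_inner_le y z

/-- The space `𝕂(X)` of compact operators: the closed linear span of the operators `|x⟩⟨y|`. -/
noncomputable def compactOperators : Submodule ℂ (X →L[ℂ] X) :=
  (Submodule.span ℂ {T | ∃ x y, T = X.rankOne x y}).topologicalClosure

theorem rankOne_mem (x y : X) : X.rankOne x y ∈ X.compactOperators :=
  Submodule.le_topologicalClosure _ (Submodule.subset_span ⟨x, y, rfl⟩)

/-- The operator `T` has an adjoint. -/
def IsAdjointable (T : X →L[ℂ] X) : Prop :=
  ∃ T' : X →L[ℂ] X, ∀ x y, X.inner (T x) y = X.inner x (T' y)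

/-- The C⋆-algebra `B` as a Hilbert module over itself. -/
noncomputable def self (B : Type*) [NonUnitalCStarAlgebra B] : HilbertModule B where
  carrier := B
  rsmul := LinearMap.mul ℂ B
  inner := LinearMap.mk₂'ₛₗ (starRingEnd ℂ) (RingHom.id ℂ) (fun x y => star x * y)
    (fun x y z => by rw [star_add, add_mul])
    (fun c x y => by rw [star_smul, smul_mul_assoc]; rfl)
    (fun x y z => mul_add _ _ _) (fun c x y => mul_smul_comm _ _ _)
  rsmul_rsmul := mul_assoc
  inner_rsmul x y b := (mul_assoc (star x) y b).symm
  star_inner x y := by simp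
  inner_self x := ⟨x, rfl⟩
  norm_sq x := by
    change ‖x‖ ^ 2 = ‖star x * x‖
    rw [CStarRing.norm_star_mul_self, sq]

end HilbertModule

namespace Correspondence

variable {A B : Type*} [NonUnitalCStarAlgebra A] [NonUnitalCStarAlgebra B]

/-- The correspondence `B`, with `A` acting through a nondegenerate homomorphism `f : A → B`. -/
noncomputable def ofHom (f : A →⋆ₙₐ[ℂ] B)
    (hf : Dense (Submodule.span ℂ {z : B | ∃ a x, z = f a * x} : Set B)) : Correspondence A B where
  toHilbertModule := HilbertModule.self B
  left :=
    { act := (NonUnitalAlgHom.Lmul ℂ B).comp (f : A →ₙₐ[ℂ] B)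
      inner_act := fun a (x : B) (y : B) => by
        change star (f a * x) * y = star x * (f (star a) * y)
        rw [star_mul, map_star, mul_assoc]
      nondegenerate := hf }

theorem dense_span_of_surjective (f : A →⋆ₙₐ[ℂ] B) (hf : Function.Surjective f) :
    Dense (Submodule.span ℂ {z : B | ∃ a x, z = f a * x} : Set B) := by
  let _ := CStarAlgebra.spectralOrder B
  let _ := CStarAlgebra.spectralOrderedRing B
  have h := CStarAlgebra.increasingApproximateUnit B
  have := h.neBot
  intro b
  refine mem_closure_of_tendsto (h.tendsto_mul_right b) (Filter.Eventually.of_forall fun e => ?_)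
  obtain ⟨a, rfl⟩ := hf e
  exact Submodule.subset_span ⟨a, b, rfl⟩

/-- The C⋆-algebra `A` as a correspondence from `A` to itself. -/
noncomputable def self (A : Type*) [NonUnitalCStarAlgebra A] : Correspondence A A :=
  ofHom (NonUnitalStarAlgHom.id ℂ A) (dense_span_of_surjective _ Function.surjective_id)

/-- A correspondence is proper if the left action is by compact operators. -/
def IsProper (X : Correspondence A B) : Prop :=
  ∀ a, X.act a ∈ X.toHilbertModule.compactOperators

/-- Isomorphisms of correspondences: unitary bimodule maps. -/
structure Iso (X Y : Correspondence A B) where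
  toLinearEquiv : X ≃ₗ[ℂ] Y
  map_act : ∀ a x, toLinearEquiv (X.act a x) = Y.act a (toLinearEquiv x)
  map_rsmul : ∀ x b, toLinearEquiv (X.rsmul x b) = Y.rsmul (toLinearEquiv x) b
  map_inner : ∀ x y, Y.inner (toLinearEquiv x) (toLinearEquiv y) = X.inner x y

instance (X Y : Correspondence A B) : CoeFun (Iso X Y) (fun _ => X → Y) :=
  ⟨fun e => e.toLinearEquiv⟩

end Correspondence

/-- The right Ore conditions on a monoid. -/
structure IsRightOre (P : Type*) [Monoid P] : Prop where
  exists_mul_eq_mul : ∀ x₁ x₂ : P, ∃ y₁ y₂ : P, x₁ * y₁ = x₂ * y₂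
  exists_mul_eq_of_mul_eq : ∀ x y₁ y₂ : P, x * y₁ = x * y₂ → ∃ z : P, y₁ * z = y₂ * z

/-- A product system over the monoid `P` with fibres `E p`: the unit fibre is identified with `A`,
and `mul p q` is an isomorphism of correspondences `E p ⊗_A E q ≅ E (p * q)`. On the unit fibre,
the multiplication is the left and right action of `A`, and it is associative. The identities
between elements of `E (1 * q)` and `E q`, and so on, are stated in the disjoint union of the
fibres. -/
structure ProductSystem {P A : Type*} [Monoid P] [NonUnitalCStarAlgebra A]
    (E : P → Correspondence A A) where
  unit : (Correspondence.self A).Iso (E 1)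
  mul : ∀ p q, ((E p).tensor (E q)).Iso (E (p * q))
  unit_mul : ∀ q (a : A) (y : E q),
    (⟨1 * q, mul 1 q ((E 1).tmul (E q) (unit a) y)⟩ : Σ p, E p) = ⟨q, (E q).act a y⟩
  mul_unit : ∀ p (x : E p) (a : A),
    (⟨p * 1, mul p 1 ((E p).tmul (E 1) x (unit a))⟩ : Σ p, E p) = ⟨p, (E p).rsmul x a⟩
  mul_assoc : ∀ p q r (x : E p) (y : E q) (z : E r),
    (⟨p * q * r, mul (p * q) r ((E (p * q)).tmul (E r) (mul p q ((E p).tmul (E q) x y)) z)⟩ :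
        Σ p, E p)
      = ⟨p * (q * r), mul p (q * r) ((E p).tmul (E (q * r)) x (mul q r ((E q).tmul (E r) y z)))⟩

namespace ProductSystem

variable {P A : Type*} [Monoid P] [NonUnitalCStarAlgebra A] {E : P → Correspondence A A}

theorem act_mul_eq_zero (𝓔 : ProductSystem E) {p : P} {a : A} (h : (E p).act a = 0) (q : P) :
    (E (p * q)).act a = 0 := by
  have h0 : ((E p).tensor (E q)).act a = 0 := by
    refine ContinuousLinearMap.coeFn_injective <| Continuous.ext_on
      ((E p).dense_span_tmul (E q)) (ContinuousLinearMap.continuous _)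
      (ContinuousLinearMap.continuous _) fun t ht => ?_
    induction ht using Submodule.span_induction with
    | mem t ht =>
      obtain ⟨x, y, rfl⟩ := ht
      refine ((E p).act_tmul (E q) a x y).trans ?_
      rw [h]
      exact congrArg (fun f => f y) (map_zero ((E p).toHilbertModule.tmulL (E q)))
    | zero => simp
    | add s t _ _ hs ht => simp only [map_add, hs, ht]
    | smul c t _ ht => simp only [map_smul, ht]
  ext z
  obtain ⟨t, rfl⟩ := (𝓔.mul p q).toLinearEquiv.surjective z
  rw [← (𝓔.mul p q).map_act, h0]
  simp

end ProductSystem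

theorem Correspondence.act_star_eq_zero {A B : Type*} [NonUnitalCStarAlgebra A]
    [NonUnitalCStarAlgebra B] (X : Correspondence A B) {a : A} (h : X.act a = 0) :
    X.act (star a) = 0 := by
  ext x
  have h1 : X.inner (X.act (star a) x) (X.act (star a) x) = 0 := by
    rw [X.left.inner_act, star_star, h]; simp
  have h2 := X.toHilbertModule.norm_sq (X.act (star a) x)
  rw [h1, norm_zero] at h2
  simpa using h2

namespace ProductSystem

variable {P A : Type*} [Monoid P] [NonUnitalCStarAlgebra A] {E : P → Correspondence A A}
  (𝓔 : ProductSystem E) (hP : IsRightOre P)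

/-- The ideal `I`, the closure of the union of the kernels of the left actions. -/
noncomputable def kernelIdeal : ClosedIdeal A where
  carrier := closure (⋃ p, {a : A | (E p).act a = 0})
  zero_mem' := subset_closure (Set.mem_iUnion.2 ⟨1, map_zero _⟩)
  add_mem' ha hb := by
    refine map_mem_closure₂ continuous_add ha hb fun a ha b hb => ?_
    obtain ⟨p, hp⟩ := Set.mem_iUnion.1 ha
    obtain ⟨q, hq⟩ := Set.mem_iUnion.1 hb
    obtain ⟨r, s, hrs⟩ := hP.exists_mul_eq_mul p q
    refine Set.mem_iUnion.2 ⟨p * r, ?_⟩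
    have h1 := 𝓔.act_mul_eq_zero hp r
    have h2 := 𝓔.act_mul_eq_zero hq s
    rw [← hrs] at h2
    exact (map_add _ _ _).trans (by rw [h1, h2, add_zero])
  smul_mem' c a ha := by
    refine map_mem_closure (continuous_const_smul c) ha fun a ha => ?_
    obtain ⟨p, hp⟩ := Set.mem_iUnion.1 ha
    exact Set.mem_iUnion.2 ⟨p, (map_smul _ _ _).trans (by rw [hp.out, smul_zero])⟩
  mul_mem_left b a ha := by
    refine map_mem_closure (continuous_const_mul b) ha fun a ha => ?_
    obtain ⟨p, hp⟩ := Set.mem_iUnion.1 ha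
    exact Set.mem_iUnion.2 ⟨p, (map_mul _ _ _).trans (by rw [hp.out, mul_zero])⟩
  mul_mem_right a b ha := by
    refine map_mem_closure (f := fun a => a * b) (continuous_mul_const b) ha fun a ha => ?_
    obtain ⟨p, hp⟩ := Set.mem_iUnion.1 ha
    exact Set.mem_iUnion.2 ⟨p, (map_mul _ _ _).trans (by rw [hp.out, zero_mul])⟩
  star_mem a ha := by
    refine map_mem_closure continuous_star ha fun a ha => ?_
    obtain ⟨p, hp⟩ := Set.mem_iUnion.1 ha
    exact Set.mem_iUnion.2 ⟨p, (E p).act_star_eq_zero hp⟩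
  isClosed := isClosed_closure

/-- The C⋆-algebra `A' = A ⧸ I`. -/
abbrev QuotientAlgebra : Type _ := (𝓔.kernelIdeal hP).Quotient

/-- The quotient map `A → A'`. -/
noncomputable abbrev quotientMap : A →⋆ₙₐ[ℂ] 𝓔.QuotientAlgebra hP := (𝓔.kernelIdeal hP).proj

/-- `A'` as a correspondence from `A` to `A'`, through the quotient map. -/
noncomputable def quotientCorrespondence : Correspondence A (𝓔.QuotientAlgebra hP) :=
  Correspondence.ofHom (𝓔.quotientMap hP)
    (Correspondence.dense_span_of_surjective _ (𝓔.kernelIdeal hP).proj_surjective)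

/-- The Hilbert `A'`-module `E'_p = E_p ⊗_A A'`. -/
noncomputable def quotientFibre (p : P) : HilbertModule (𝓔.QuotientAlgebra hP) :=
  (E p).toHilbertModule.tensor (𝓔.quotientCorrespondence hP)

/-- `E'_p` with a left action of `A'`, as a correspondence from `A'` to itself. -/
noncomputable abbrev quotientFibres
    (L : ∀ p, LeftAction (𝓔.QuotientAlgebra hP) (𝓔.quotientFibre hP p)) (p : P) :
    Correspondence (𝓔.QuotientAlgebra hP) (𝓔.QuotientAlgebra hP) :=
  ⟨𝓔.quotientFibre hP p, L p⟩

/-- The elementary tensor `x ⊗ b` in `E'_p`. -/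
noncomputable def quotientTmul (p : P) (x : E p) (b : 𝓔.QuotientAlgebra hP) :
    𝓔.quotientFibre hP p :=
  (E p).toHilbertModule.tmul (𝓔.quotientCorrespondence hP) x b

/-- A nondegenerate representation of the product system on a Hilbert `B`-module `F`: a
correspondence structure from `A` to `B` on `F` and linear maps `S p` from `E p` to the adjointable
operators on `F` with `S p (a · x) = a · S p x`, `(S p x)* S p y = ⟨x, y⟩` (written out with
vectors `v`, `w` of `F`), `S p x * S q y = S (p * q) (x y)` and with `S p (E p) F` spanning a dense
subspace; on the unit fibre `A`, it is the left action on `F`. -/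
structure NondegenerateRepresentation {B : Type*} [NonUnitalCStarAlgebra B]
    (F : HilbertModule B) where
  left : LeftAction A F
  S : ∀ p, E p →ₗ[ℂ] (F →L[ℂ] F)
  adjointable : ∀ p x, F.IsAdjointable (S p x)
  S_unit : ∀ a : A, S 1 (𝓔.unit a) = left.act a
  S_act : ∀ p a x, S p ((E p).act a x) = left.act a * S p x
  inner_S : ∀ p x y v w, F.inner (S p x v) (S p y w) = F.inner v (left.act ((E p).inner x y) w)
  S_mul : ∀ p q x y, S p x * S q y = S (p * q) (𝓔.mul p q ((E p).tmul (E q) x y))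
  nondegenerate : ∀ p, Dense (Submodule.span ℂ {w : F | ∃ x v, w = S p x v} : Set F)

/-- A Cuntz-Pimsner covariant representation of the product system in a C⋆-algebra `B`. For each
`p` there is a (necessarily unique) bounded linear map `ϑ` from `𝕂(E p)` to `B` with
`ϑ |x⟩⟨y| = S p x * (S p y)*`; covariance says that `ϑ (φ_p a) = hom a` whenever the left action
`φ_p a` of `a` on `E p` is compact. -/
structure CovariantRepresentation (B : Type*) [NonUnitalCStarAlgebra B] where
  hom : A →⋆ₙₐ[ℂ] B
  S : ∀ p, E p →ₗ[ℂ] B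
  S_unit : ∀ a : A, S 1 (𝓔.unit a) = hom a
  S_act : ∀ p a x, S p ((E p).act a x) = hom a * S p x
  inner_S : ∀ p x y, star (S p x) * S p y = hom ((E p).inner x y)
  S_mul : ∀ p q x y, S p x * S q y = S (p * q) (𝓔.mul p q ((E p).tmul (E q) x y))
  covariant : ∀ p, ∃ ϑ : (E p).toHilbertModule.compactOperators →L[ℂ] B,
    (∀ x y, ϑ ⟨(E p).toHilbertModule.rankOne x y, (E p).toHilbertModule.rankOne_mem x y⟩
      = S p x * star (S p y)) ∧
    ∀ a (ha : (E p).act a ∈ (E p).toHilbertModule.compactOperators), ϑ ⟨(E p).act a, ha⟩ = hom a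

end ProductSystem

namespace ProductSystem
universe u v w

variable {P : Type w} {A : Type u} [Monoid P] [NonUnitalCStarAlgebra A]
  {E : P → Correspondence.{v} A A} (𝓔 : ProductSystem E)

theorem CovariantRepresentation.norm_S_le {𝓔 : ProductSystem E} {B : Type*}
    [NonUnitalCStarAlgebra B] (ρ : 𝓔.CovariantRepresentation B) (p : P) (x : E p) :
    ‖ρ.S p x‖ ≤ ‖x‖ := by
  refine le_of_sq_le_sq ?_ (norm_nonneg _)
  rw [(E p).toHilbertModule.norm_sq, sq, ← CStarRing.norm_star_mul_self, ρ.inner_S]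
  exact NonUnitalStarAlgHom.norm_apply_le ρ.hom _

/-- The Cuntz-Pimsner covariant representations of the product system in C⋆-algebras. (A C⋆-algebra
that is generated by a covariant representation always has a copy in this universe.) -/
structure CovariantIndex : Type (max u v w + 1) where
  B : Type (max u v w)
  [cstar : NonUnitalCStarAlgebra B]
  rep : 𝓔.CovariantRepresentation B

attribute [instance] CovariantIndex.cstar

/-- The product of all covariant representations. -/
noncomputable def cuntzPimsnerAux (p : P) (x : E p) :
    lp (fun ρ : 𝓔.CovariantIndex => ρ.B) ∞ :=
  ⟨fun ρ => ρ.rep.S p x, memℓp_infty ⟨‖x‖, by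
    rintro _ ⟨ρ, rfl⟩
    exact ρ.rep.norm_S_le p x⟩⟩

/-- The Cuntz-Pimsner algebra, the universal C⋆-algebra for Cuntz-Pimsner covariant
representations: the C⋆-subalgebra generated by the product of all of them in the `ℓ^∞`-product
of their targets. -/
noncomputable def cuntzPimsner :
    NonUnitalStarSubalgebra ℂ (lp (fun ρ : 𝓔.CovariantIndex => ρ.B) ∞) :=
  (NonUnitalStarAlgebra.adjoin ℂ {t | ∃ p x, t = 𝓔.cuntzPimsnerAux p x}).topologicalClosure

/-- The canonical map from the fibre `E p` to the Cuntz-Pimsner algebra. -/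
noncomputable def toCuntzPimsner (p : P) (x : E p) : ↥𝓔.cuntzPimsner :=
  ⟨𝓔.cuntzPimsnerAux p x, NonUnitalStarSubalgebra.le_topologicalClosure _
    (NonUnitalStarAlgebra.subset_adjoin ℂ _ ⟨p, x, rfl⟩)⟩

/-- The Cuntz-Pimsner algebra as a C⋆-algebra. -/
abbrev CuntzPimsner : Type _ := 𝓔.cuntzPimsner

instance : IsClosed (𝓔.cuntzPimsner : Set (lp (fun ρ : 𝓔.CovariantIndex => ρ.B) ∞)) :=
  NonUnitalStarSubalgebra.isClosed_topologicalClosure _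

/-- Every covariant representation factors uniquely through the Cuntz-Pimsner algebra. -/
theorem existsUnique_lift {B : Type (max u v w)} [NonUnitalCStarAlgebra B]
    (ρ : 𝓔.CovariantRepresentation B) :
    ∃! Φ : 𝓔.CuntzPimsner →⋆ₙₐ[ℂ] B, ∀ p x, Φ (𝓔.toCuntzPimsner p x) = ρ.S p x := by
  let i : 𝓔.CovariantIndex := ⟨B, ρ⟩
  let ev : lp (fun ρ : 𝓔.CovariantIndex => ρ.B) ∞ →⋆ₙₐ[ℂ] B :=
    { toFun := fun t => t i
      map_smul' := fun _ _ => rfl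
      map_zero' := rfl
      map_add' := fun _ _ => rfl
      map_mul' := fun _ _ => rfl
      map_star' := fun _ => rfl }
  let S := 𝓔.cuntzPimsner
  let ev' : 𝓔.CuntzPimsner →⋆ₙₐ[ℂ] B := ev.comp (NonUnitalStarSubalgebraClass.subtype S)
  refine ⟨ev', fun p x => rfl, fun Ψ hΨ => ?_⟩
  let D : NonUnitalStarSubalgebra ℂ 𝓔.CuntzPimsner := NonUnitalStarAlgHom.equalizer Ψ ev'
  let D' := D.map (NonUnitalStarSubalgebraClass.subtype S)
  have hD : IsClosed (D : Set 𝓔.CuntzPimsner) :=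
    isClosed_eq
      (AddMonoidHomClass.continuous_of_bound Ψ 1 fun x => by
        rw [one_mul]; exact NonUnitalStarAlgHom.norm_apply_le Ψ x)
      (AddMonoidHomClass.continuous_of_bound ev' 1 fun x => by
        rw [one_mul]; exact NonUnitalStarAlgHom.norm_apply_le ev' x)
  have hD' : IsClosed (D' : Set (lp (fun ρ : 𝓔.CovariantIndex => ρ.B) ∞)) := by
    have hSc : IsClosed (S : Set (lp (fun ρ : 𝓔.CovariantIndex => ρ.B) ∞)) := inferInstance
    exact hSc.isClosedEmbedding_subtypeVal.isClosedMap D hD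
  have hS : S ≤ D' := by
    refine NonUnitalStarSubalgebra.topologicalClosure_minimal _ (NonUnitalStarAlgebra.adjoin_le ?_)
      hD'
    rintro _ ⟨p, x, rfl⟩
    exact ⟨𝓔.toCuntzPimsner p x, hΨ p x, rfl⟩
  ext x
  obtain ⟨y, hy, hxy⟩ := hS x.2
  rw [← Subtype.ext hxy]
  exact hy

end ProductSystem

/-! Write `φ_p` for the left action on `E p` and `π : A → A'` for the quotient map. The ideal `I` is
invariant: `⟨x, a · y⟩ ∈ I` for `a ∈ I`. Indeed, let `φ_r a = 0` and choose `p * s = r * t` by the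
Ore condition. Then `a` acts by zero on `E (p * s) ≅ E p ⊗ E s`, and the matrix coefficients of this
operator show that `φ_s ⟨x, a · y⟩ = 0`. This is `inner_act_mem_kernelIdeal`.

The map `q_p : E_p → E'_p` satisfies `⟨q x, q y⟩ = π ⟨x, y⟩`. By an approximate unit of `I`, such a
map has kernel the closed span of `E_p · I`, and vectors in its range lift with almost the same
norm, so that its range is closed. Invariance of `I` lets the action of `A` descend to `A'`. The
multiplication and the unit descend because the old and the new elementary tensors have the same
inner products up to `π`. The axioms of a product system then follow from surjectivity of the maps
`q_p`.

Faithfulness uses compactness. If `π a` acts by zero on `E'_p`, then `φ_p a` maps `E_p` into the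
closed span of `E_p · I`. Being compact, `φ_p a` is a limit of combinations of operators `|φ_p(a)
x⟩⟨y|`, hence of combinations of operators `|z · b⟩⟨y|` with `φ_r b = 0` for some `r`. The latter
vanish after tensoring with the identity of `E_r`, and by the Ore condition one `r` serves for a
finite sum. So `φ_p a` is within `ε` of some `F` with `F ⊗ 1 = 0` on `E_p ⊗ E_r`, which gives
`‖φ_(pr) a‖ < ε`. This norm is the distance from `a` to `ker φ_(pr)`, so `a ∈ I`. This is
`quotientLeft_injective`.

A representation kills `I`: if `φ_r a = 0`, then `a S_r(x) = S_r(a x) = 0`, and nondegeneracy gives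
that `a` acts by zero; for a covariant representation, `a` is mapped to `ϑ (φ_r a) = 0`. Since
`S_p(x)* S_p(x)` is the image of `⟨x, x⟩`, the maps `S_p` then factor through `q_p`. For the
covariance of the factored representation, a bounded map on `𝕂(E'_p)` is needed;
`exists_compactOperators_hom_of_inner` provides it. Thus both systems have the same representations
of either kind, and hence isomorphic universal algebras. -/

/-! ### Maps determined on generators: closed spans, Hilbert modules, compact operators -/

theorem Submodule.denseRange_linearCombination_codRestrict {W ι : Type*} [NormedAddCommGroup W]
    [NormedSpace ℂ W] (r : ι → W) (K : Submodule ℂ W)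
    (hK : K = (Submodule.span ℂ (Set.range r)).topologicalClosure) (hr : ∀ i, r i ∈ K) :
    DenseRange (Finsupp.linearCombination ℂ fun i => (⟨r i, hr i⟩ : K)) := by
  intro T
  have hT : (T : W) ∈ closure (Submodule.span ℂ (Set.range r) : Set W) :=
    hK.le T.2
  rw [closure_subtype]
  refine closure_mono ?_ hT
  rw [← Finsupp.range_linearCombination]
  rintro _ ⟨t, rfl⟩
  exact ⟨_, ⟨t, rfl⟩, by simp [Finsupp.linearCombination_apply, Finsupp.sum]⟩

/-- A norm-decreasing assignment on a generating set extends to the closed linear span. -/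
theorem Submodule.exists_extension_topologicalClosure_span {W V ι : Type*} [NormedAddCommGroup W]
    [NormedSpace ℂ W] [NormedAddCommGroup V] [NormedSpace ℂ V] [CompleteSpace V]
    (r : ι → W) (k : ι → V) (K : Submodule ℂ W)
    (hK : K = (Submodule.span ℂ (Set.range r)).topologicalClosure) (hr : ∀ i, r i ∈ K)
    (hk : ∀ t, ‖Finsupp.linearCombination ℂ k t‖ ≤ ‖Finsupp.linearCombination ℂ r t‖) :
    ∃ f : K →L[ℂ] V, ∀ i, f ⟨r i, hr i⟩ = k i := by
  have e : ∀ t, ((Finsupp.linearCombination ℂ (fun i => (⟨r i, hr i⟩ : K)) t : K) : W)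
      = Finsupp.linearCombination ℂ r t := fun t => by
    simp [Finsupp.linearCombination_apply, Finsupp.sum]
  have hk' : ∀ t, ‖Finsupp.linearCombination ℂ k t‖
      ≤ 1 * ‖Finsupp.linearCombination ℂ (fun i => (⟨r i, hr i⟩ : K)) t‖ :=
    fun t => (hk t).trans_eq <| by rw [one_mul, ← e]; rfl
  refine ⟨(Finsupp.linearCombination ℂ k).extendOfNorm
    (Finsupp.linearCombination ℂ fun i => (⟨r i, hr i⟩ : K)), fun i => ?_⟩
  have := LinearMap.extendOfNorm_eq
    (Submodule.denseRange_linearCombination_codRestrict r K hK hr) ⟨1, hk'⟩ (Finsupp.single i 1)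
  simpa using this

namespace HilbertModule

variable {A B : Type*} [NonUnitalCStarAlgebra A] [NonUnitalCStarAlgebra B]

theorem eq_zero_of_inner_self_eq_zero (X : HilbertModule B) {x : X} (h : X.inner x x = 0) :
    x = 0 := by
  have h2 := X.norm_sq x
  rw [h, norm_zero] at h2
  simpa using h2

theorem eq_of_inner_left_eq (X : HilbertModule B) {x y : X}
    (h : ∀ z, X.inner z x = X.inner z y) : x = y :=
  sub_eq_zero.1 <| X.eq_zero_of_inner_self_eq_zero <| by
    rw [map_sub (X.inner (x - y)), h, sub_self]

/-- The inner product as a bounded sesquilinear map. -/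
noncomputable def innerL (X : HilbertModule B) : X →L⋆[ℂ] X →L[ℂ] B :=
  X.inner.mkContinuous₂ 1 fun x y => by simpa using X.norm_inner_le x y

theorem innerL_apply (X : HilbertModule B) (x y : X) : X.innerL x y = X.inner x y := rfl

/-- The right action as a bounded bilinear map. -/
noncomputable def rsmulL (X : HilbertModule B) : X →L[ℂ] B →L[ℂ] X :=
  X.rsmul.mkContinuous₂ 1 fun x b => by simpa using X.norm_rsmul_le x b

section Hom

variable {X : HilbertModule A} {Y : HilbertModule B} {π : A →⋆ₙₐ[ℂ] B}

/-- A map between generating sets that respects inner products extends to the modules. -/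
theorem exists_continuousLinearMap {T : Type*} (π : A →⋆ₙₐ[ℂ] B) (f : T → X) (g : T → Y)
    (hf : Dense (Submodule.span ℂ (Set.range f) : Set X))
    (h : ∀ s t, Y.inner (g s) (g t) = π (X.inner (f s) (f t))) :
    ∃ U : X →L[ℂ] Y, (∀ t, U (f t) = g t) ∧ ∀ x y, Y.inner (U x) (U y) = π (X.inner x y) := by
  -- By sesquilinearity, formal combinations inherit the compatibility of inner products. As `π` is
  -- contractive, `‖k t‖ ≤ ‖e t‖`, so `k` factors through the dense range of `e` and extends by
  -- continuity.
  let e : (T →₀ ℂ) →ₗ[ℂ] X := Finsupp.linearCombination ℂ f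
  let k : (T →₀ ℂ) →ₗ[ℂ] Y := Finsupp.linearCombination ℂ g
  have hin : ∀ s t, Y.inner (k s) (k t) = π (X.inner (e s) (e t)) := fun s t => by
    simp only [k, e, Finsupp.linearCombination_apply, Finsupp.sum, map_sum, LinearMap.sum_apply,
      map_smul, LinearMap.map_smulₛₗ, LinearMap.smul_apply, h]
  have hd : DenseRange e := by
    rw [DenseRange, ← LinearMap.coe_range, Finsupp.range_linearCombination]
    exact hf
  have hn : ∀ t, ‖k t‖ ≤ 1 * ‖e t‖ := fun t => by
    rw [one_mul, Y.norm_eq, X.norm_eq, hin]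
    exact Real.sqrt_le_sqrt (NonUnitalStarAlgHom.norm_apply_le π _)
  have hU := LinearMap.extendOfNorm_eq hd ⟨1, hn⟩
  refine ⟨k.extendOfNorm e, fun t => ?_, fun x y => ?_⟩
  · have := hU (Finsupp.single t 1)
    simpa [k, e] using this
  · have hπ : Continuous π := AddMonoidHomClass.continuous_of_bound π 1 fun x => by
      rw [one_mul]; exact NonUnitalStarAlgHom.norm_apply_le π x
    have : (fun p : X × X => Y.innerL (k.extendOfNorm e p.1) (k.extendOfNorm e p.2))
        = fun p => π (X.innerL p.1 p.2) := by
      refine (hd.prodMap hd).equalizer (by fun_prop)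
        (hπ.comp (by fun_prop)) (funext fun p => ?_)
      simp only [Function.comp_apply, Prod.map, hU, innerL_apply, hin]
    exact congrFun this (x, y)

variable {U : X →L[ℂ] Y}

theorem norm_map_le_of_inner (hU : ∀ x y, Y.inner (U x) (U y) = π (X.inner x y)) (x : X) :
    ‖U x‖ ≤ ‖x‖ := by
  rw [Y.norm_eq, X.norm_eq, hU]
  exact Real.sqrt_le_sqrt (NonUnitalStarAlgHom.norm_apply_le π _)

/-- Module linearity is automatic: in the inner square of `U (x · a) - U x · π a`, all four terms
are `± π (a* ⟨x, x⟩ a)` and they cancel. -/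
theorem map_rsmul_of_inner (hU : ∀ x y, Y.inner (U x) (U y) = π (X.inner x y)) (x : X) (a : A) :
    U (X.rsmul x a) = Y.rsmul (U x) (π a) := by
  refine sub_eq_zero.1 (Y.eq_zero_of_inner_self_eq_zero ?_)
  simp only [map_sub, LinearMap.sub_apply, Y.inner_rsmul, Y.inner_rsmul_left, hU, X.inner_rsmul,
    X.inner_rsmul_left, map_mul, map_star]
  simp [mul_assoc]

theorem map_rankOne_of_inner (hU : ∀ x y, Y.inner (U x) (U y) = π (X.inner x y)) (x y z : X) :
    U (X.rankOne x y z) = Y.rankOne (U x) (U y) (U z) := by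
  refine (map_rsmul_of_inner hU x (X.inner y z)).trans ?_
  rw [← hU]; rfl

/-- Two maps with dense range that have the same inner products differ by a unitary. -/
theorem exists_unitary {Y X : HilbertModule B} {T : Type*} (f : T → X) (g : T → Y)
    (hf : Dense (Submodule.span ℂ (Set.range f) : Set X))
    (hg : Dense (Submodule.span ℂ (Set.range g) : Set Y))
    (h : ∀ s t, Y.inner (g s) (g t) = X.inner (f s) (f t)) :
    ∃ U : X ≃ₗ[ℂ] Y, (∀ t, U (f t) = g t) ∧ (∀ x b, U (X.rsmul x b) = Y.rsmul (U x) b) ∧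
      (∀ x y, Y.inner (U x) (U y) = X.inner x y) ∧ Continuous U := by
  obtain ⟨U, hU, hU'⟩ := exists_continuousLinearMap (NonUnitalStarAlgHom.id ℂ B) f g hf h
  obtain ⟨V, hV, hV'⟩ := exists_continuousLinearMap (NonUnitalStarAlgHom.id ℂ B) g f hg
    fun s t => (h s t).symm
  have h1 : V.comp U = ContinuousLinearMap.id ℂ X :=
    ContinuousLinearMap.ext_on hf <| by rintro _ ⟨t, rfl⟩; simp [hU, hV]
  have h2 : U.comp V = ContinuousLinearMap.id ℂ Y :=
    ContinuousLinearMap.ext_on hg <| by rintro _ ⟨t, rfl⟩; simp [hU, hV]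
  exact ⟨LinearEquiv.ofLinearMap U.toLinearMap V.toLinearMap
    (LinearMap.ext fun x => DFunLike.congr_fun h2 x)
    (LinearMap.ext fun x => DFunLike.congr_fun h1 x),
    hU, fun x b => map_rsmul_of_inner hU' x b, hU', U.continuous⟩

end Hom

section Compact

variable (X : HilbertModule B)

theorem rankOne_apply (x y z : X) : X.rankOne x y z = X.rsmul x (X.inner y z) := rfl

/-- The operators `|x⟩⟨y|` as a bounded linear map in `x`. -/
noncomputable def rankOneL (y : X) : X →L[ℂ] (X →L[ℂ] X) :=
  LinearMap.mkContinuous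
    { toFun := fun x => X.rankOne x y
      map_add' := fun x x' => by ext z; simp [rankOne_apply]
      map_smul' := fun c x => by ext z; simp [rankOne_apply] } ‖y‖ fun x => by
    refine ContinuousLinearMap.opNorm_le_bound _ (by positivity) fun z => ?_
    refine (X.norm_rsmul_le _ _).trans ?_
    rw [mul_comm ‖y‖, mul_assoc]
    gcongr
    exact X.norm_inner_le y z

theorem compactOperators_eq : X.compactOperators = (Submodule.span ℂ
    (Set.range fun p : X × X => X.rankOne p.1 p.2)).topologicalClosure := by
  unfold compactOperators
  congr 2
  ext T
  simp [eq_comm]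

/-- The operator `|x⟩⟨y|` as an element of the space of compact operators. -/
noncomputable def compactRankOne (x y : X) : X.compactOperators :=
  ⟨X.rankOne x y, X.rankOne_mem x y⟩

variable {X} in
theorem compactOperators_hom_ext {V : Type*} [NormedAddCommGroup V] [NormedSpace ℂ V]
    {f g : X.compactOperators →L[ℂ] V}
    (h : ∀ x y, f (X.compactRankOne x y) = g (X.compactRankOne x y)) : f = g := by
  refine ContinuousLinearMap.coeFn_injective
    ((Submodule.denseRange_linearCombination_codRestrict _ _ X.compactOperators_eq
      fun p => X.rankOne_mem p.1 p.2).equalizer f.continuous g.continuous (funext fun t => ?_))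
  have h' : ∀ p : X × X, f ⟨X.rankOne p.1 p.2, X.rankOne_mem p.1 p.2⟩
    = g ⟨X.rankOne p.1 p.2, X.rankOne_mem p.1 p.2⟩ := fun p => h p.1 p.2
  simp only [Function.comp_apply, Finsupp.linearCombination_apply, Finsupp.sum, map_sum, map_smul,
    h']

theorem exists_compactOperators_hom {V : Type*} [NormedAddCommGroup V] [NormedSpace ℂ V]
    [CompleteSpace V] (k : X × X → V)
    (hk : ∀ t, ‖Finsupp.linearCombination ℂ k t‖
      ≤ ‖Finsupp.linearCombination ℂ (fun p : X × X => X.rankOne p.1 p.2) t‖) :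
    ∃ f : X.compactOperators →L[ℂ] V, ∀ x y, f (X.compactRankOne x y) = k (x, y) := by
  obtain ⟨f, hf⟩ := Submodule.exists_extension_topologicalClosure_span _ k _ X.compactOperators_eq
    (fun p => X.rankOne_mem p.1 p.2) hk
  exact ⟨f, fun x y => hf (x, y)⟩

end Compact

end HilbertModule

/-! ### The C⋆-algebra of adjointable operators and its ideal of compact operators -/

namespace HilbertModule

variable {A B C : Type*} [NonUnitalCStarAlgebra A] [NonUnitalCStarAlgebra B]
  [NonUnitalCStarAlgebra C] (X : HilbertModule B)

/-- The algebra `𝔹(X)` of adjointable operators. -/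
noncomputable def adjointable : Subalgebra ℂ (X →L[ℂ] X) where
  carrier := {T | X.IsAdjointable T}
  mul_mem' := by
    rintro S T ⟨S', hS⟩ ⟨T', hT⟩
    exact ⟨T' * S', fun x y => (hS _ _).trans (hT _ _)⟩
  add_mem' := by
    rintro S T ⟨S', hS⟩ ⟨T', hT⟩
    exact ⟨S' + T', fun x y => by simp [hS, hT]⟩
  algebraMap_mem' c := ⟨algebraMap ℂ _ (conj c), fun x y => by
    simp [Algebra.algebraMap_eq_smul_one]⟩

namespace Adjointable

variable {X}

/-- The adjoint of an adjointable operator. -/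
noncomputable instance : Star X.adjointable where
  star T := ⟨T.2.choose, T, fun x y => by
    rw [← X.star_inner, ← T.2.choose_spec, X.star_inner]⟩

theorem inner_left (T : X.adjointable) (x y : X) :
    X.inner (T.1 x) y = X.inner x ((star T).1 y) := T.2.choose_spec x y

theorem eq_of_inner {S T : X.adjointable} (h : ∀ x y, X.inner x (S.1 y) = X.inner x (T.1 y)) :
    S = T := Subtype.ext <| ContinuousLinearMap.ext fun y => X.eq_of_inner_left_eq fun x => h x y

theorem inner_right (T : X.adjointable) (x y : X) :
    X.inner x (T.1 y) = X.inner ((star T).1 x) y := by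
  rw [← X.star_inner, inner_left, X.star_inner]

noncomputable instance : StarRing X.adjointable where
  star_involutive T := eq_of_inner fun x y => by rw [← inner_left, ← inner_right]
  star_mul S T := eq_of_inner fun x y => by
    rw [← inner_left]
    change X.inner (S.1 (T.1 x)) y = X.inner x ((star T).1 ((star S).1 y))
    rw [inner_left, inner_left]
  star_add S T := eq_of_inner fun x y => by
    rw [← inner_left]
    change X.inner (S.1 x + T.1 x) y = X.inner x ((star S).1 y + (star T).1 y)
    rw [map_add, map_add, LinearMap.add_apply, inner_left, inner_left]

instance : StarModule ℂ X.adjointable where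
  star_smul c T := eq_of_inner fun x y => by
    rw [← inner_left]
    change X.inner (c • T.1 x) y = X.inner x (star c • (star T).1 y)
    rw [LinearMap.map_smulₛₗ, LinearMap.smul_apply, inner_left, map_smul]
    rfl

/-- By the Cauchy-Schwarz inequality, `‖T x‖² = ‖⟨x, T*T x⟩‖ ≤ ‖T*T‖ ‖x‖²`. -/
instance : CStarRing X.adjointable where
  norm_mul_self_le T := by
    change ‖T.1‖ * ‖T.1‖ ≤ ‖(star T * T).1‖
    rw [← sq]
    refine (Real.le_sqrt (norm_nonneg _) (norm_nonneg _)).1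
      (ContinuousLinearMap.opNorm_le_bound _ (Real.sqrt_nonneg _) fun x => ?_)
    refine le_of_sq_le_sq ?_ (by positivity)
    rw [mul_pow, Real.sq_sqrt (norm_nonneg _), X.norm_sq, inner_left]
    refine (X.norm_inner_le _ _).trans ?_
    calc ‖x‖ * ‖(star T * T).1 x‖ ≤ ‖x‖ * (‖(star T * T).1‖ * ‖x‖) := by
          gcongr; exact ContinuousLinearMap.le_opNorm _ _
      _ = _ := by ring

/-- The C⋆-inequality already makes the adjoint isometric, so the adjoints of a Cauchy sequence are
again Cauchy. The two limits are adjoint to each other by continuity of the inner product. -/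
instance : CompleteSpace X.adjointable := by
  refine Metric.complete_of_cauchySeq_tendsto fun u hu => ?_
  have h1 : CauchySeq fun n => (u n).1 := hu.map uniformContinuous_subtype_val
  have hs : UniformContinuous (star : X.adjointable → X.adjointable) :=
    (starₗᵢ ℂ (E := X.adjointable)).isometry.uniformContinuous
  have h2 : CauchySeq fun n => (star (u n)).1 :=
    hu.map (uniformContinuous_subtype_val.comp hs)
  obtain ⟨T, hT⟩ := cauchySeq_tendsto_of_complete h1
  obtain ⟨T', hT'⟩ := cauchySeq_tendsto_of_complete h2
  refine ⟨⟨T, T', fun x y => ?_⟩, tendsto_subtype_rng.2 hT⟩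
  have e1 : Filter.Tendsto (fun n => X.innerL ((u n).1 x) y) Filter.atTop
      (nhds (X.innerL (T x) y)) :=
    ((by fun_prop : Continuous fun S : X →L[ℂ] X => X.innerL (S x) y).tendsto T).comp hT
  have e2 : Filter.Tendsto (fun n => X.innerL x ((star (u n)).1 y)) Filter.atTop
      (nhds (X.innerL x (T' y))) :=
    ((by fun_prop : Continuous fun S : X →L[ℂ] X => X.innerL x (S y)).tendsto T').comp hT'
  exact tendsto_nhds_unique (e1.congr fun n => inner_left (u n) x y) e2

noncomputable instance : NonUnitalCStarAlgebra X.adjointable where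

variable (X) in
/-- The operator `|x⟩⟨y|` as an adjointable operator. -/
noncomputable def rankOne (x y : X) : X.adjointable :=
  ⟨X.rankOne x y, X.rankOne y x, fun z w => by
    rw [rankOne_apply, rankOne_apply, X.inner_rsmul, X.inner_rsmul_left, X.star_inner]⟩

theorem star_rankOne (x y : X) : star (rankOne X x y) = rankOne X y x :=
  eq_of_inner fun z w => by
    rw [← inner_left]
    change X.inner (X.rsmul x (X.inner y z)) w = X.inner z (X.rsmul y (X.inner x w))
    rw [X.inner_rsmul, X.inner_rsmul_left, X.star_inner]

/-- Adjointable operators are `B`-linear because `⟨z, T (x b)⟩ = ⟨T* z, x⟩ b`. -/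
theorem map_rsmul (T : X.adjointable) (x : X) (b : B) : T.1 (X.rsmul x b) = X.rsmul (T.1 x) b :=
  X.eq_of_inner_left_eq fun z => by
    rw [X.inner_rsmul, inner_right, inner_right, X.inner_rsmul]

theorem mul_rankOne (T : X.adjointable) (x y : X) : T * rankOne X x y = rankOne X (T.1 x) y :=
  Subtype.ext <| ContinuousLinearMap.ext fun z => map_rsmul T x (X.inner y z)

variable (X) in
/-- The ideal `𝕂(X)` in `𝔹(X)`. -/
noncomputable def compactIdeal : ClosedIdeal X.adjointable where
  __ := (Submodule.span ℂ {T | ∃ x y, T = rankOne X x y}).topologicalClosure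
  isClosed := Submodule.isClosed_topologicalClosure _
  star_mem T hT := by
    refine map_mem_closure continuous_star hT fun S hS => ?_
    induction hS using Submodule.span_induction with
    | mem S hS =>
      obtain ⟨x, y, rfl⟩ := hS
      exact Submodule.subset_span ⟨y, x, star_rankOne x y⟩
    | zero => rw [star_zero]; exact Submodule.zero_mem _
    | add S T _ _ hS hT => rw [star_add]; exact Submodule.add_mem _ hS hT
    | smul c S _ hS => rw [star_smul]; exact Submodule.smul_mem _ _ hS
  mul_mem_left T K hK := by
    refine map_mem_closure (continuous_const_mul T) hK fun S hS => ?_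
    induction hS using Submodule.span_induction with
    | mem S hS =>
      obtain ⟨x, y, rfl⟩ := hS
      exact Submodule.subset_span ⟨T.1 x, y, mul_rankOne T x y⟩
    | zero => rw [mul_zero]; exact Submodule.zero_mem _
    | add S S' _ _ hS hT => rw [mul_add]; exact Submodule.add_mem _ hS hT
    | smul c S _ hS => rw [mul_smul_comm]; exact Submodule.smul_mem _ _ hS
  mul_mem_right K T hK := by
    refine map_mem_closure (f := (· * T)) (continuous_mul_const T) hK fun S hS => ?_
    change S * T ∈ Submodule.span ℂ {T | ∃ x y, T = rankOne X x y}
    induction hS using Submodule.span_induction with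
    | mem S hS =>
      obtain ⟨x, y, rfl⟩ := hS
      refine Submodule.subset_span ⟨x, (star T).1 y, ?_⟩
      rw [← star_star (rankOne X x y * T), star_mul, star_rankOne, mul_rankOne, star_rankOne]
    | zero => rw [zero_mul]; exact Submodule.zero_mem _
    | add S S' _ _ hS hT => rw [add_mul]; exact Submodule.add_mem _ hS hT
    | smul c S _ hS => rw [smul_mul_assoc]; exact Submodule.smul_mem _ _ hS

/-- The rank-one operators are adjointable, and the norm of `𝔹(X)` is the operator norm, so it does
not matter in which of the two algebras the closure is taken. In this form, approximate units of a
closed ideal become available for `𝕂(X)`. -/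
theorem mem_compactIdeal {T : X.adjointable} (hT : T.1 ∈ X.compactOperators) :
    T ∈ (compactIdeal X).toSubmodule := by
  change T ∈ closure _
  rw [closure_subtype]
  refine closure_mono ?_ hT
  intro S hS
  induction hS using Submodule.span_induction with
  | mem S hS =>
    obtain ⟨x, y, rfl⟩ := hS
    exact ⟨rankOne X x y, Submodule.subset_span ⟨x, y, rfl⟩, rfl⟩
  | zero => exact ⟨0, Submodule.zero_mem _, rfl⟩
  | add S S' _ _ hS hS' =>
    obtain ⟨T, hT, rfl⟩ := hS
    obtain ⟨T', hT', rfl⟩ := hS'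
    exact ⟨_, Submodule.add_mem _ hT hT', rfl⟩
  | smul c S _ hS =>
    obtain ⟨T, hT, rfl⟩ := hS
    exact ⟨_, Submodule.smul_mem _ c hT, rfl⟩

/-- A compact operator `T` is approximated by the operators `|T x⟩⟨y|`. -/
theorem mem_of_forall_rankOne_mem {T : X.adjointable} (hT : T.1 ∈ X.compactOperators)
    (M : Submodule ℂ X.adjointable) (hM : IsClosed (M : Set X.adjointable))
    (h : ∀ x y, rankOne X (T.1 x) y ∈ M) : T ∈ M := by
  -- The condition `T * K ∈ M` is linear and closed in `K`, and `T |x⟩⟨y| = |T x⟩⟨y|` settles the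
  -- generators.
  have h1 : ∀ K ∈ (compactIdeal X).toSubmodule, T * K ∈ M := fun K hK => by
    refine closure_minimal (t := (T * ·) ⁻¹' (M : Set X.adjointable)) ?_
      (hM.preimage (continuous_const_mul T)) hK
    intro S hS
    change T * S ∈ M
    induction hS using Submodule.span_induction with
    | mem S hS =>
      obtain ⟨x, y, rfl⟩ := hS
      rw [mul_rankOne]; exact h x y
    | zero => rw [mul_zero]; exact Submodule.zero_mem _
    | add S S' _ _ hS hT => rw [mul_add]; exact Submodule.add_mem _ hS hT
    | smul c S _ hS => rw [mul_smul_comm]; exact Submodule.smul_mem _ _ hS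
  refine hM.closure_subset_iff.2 subset_rfl (Metric.mem_closure_iff.2 fun ε hε => ?_)
  -- The approximate unit multiplies from the left, so it is applied to `T*`. As `e` is
  -- self-adjoint, `‖T - T e‖ = ‖T* - e T*‖`.
  obtain ⟨e, he, hes, -, hTe⟩ := (compactIdeal X).exists_approx (star T)
    ((compactIdeal X).star_mem _ (mem_compactIdeal hT)) hε
  refine ⟨T * e, h1 e he, ?_⟩
  rw [dist_eq_norm, ← norm_star, star_sub, star_mul, hes]
  exact hTe

variable (X) in
/-- `X` as a correspondence from `𝔹(X)` to `B`. -/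
noncomputable def correspondence : Correspondence X.adjointable B where
  toHilbertModule := X
  left :=
    { act := (X.adjointable.val : X.adjointable →ₙₐ[ℂ] (X →L[ℂ] X))
      inner_act := inner_left
      nondegenerate := fun x => subset_closure (Submodule.subset_span ⟨1, x, rfl⟩) }

end Adjointable

end HilbertModule

/-- A left action as a homomorphism into the algebra of adjointable operators. -/
noncomputable def LeftAction.toAdjointable {A B : Type*} [NonUnitalCStarAlgebra A]
    [NonUnitalCStarAlgebra B] {X : HilbertModule B} (L : LeftAction A X) :
    A →⋆ₙₐ[ℂ] X.adjointable where
  toFun a := ⟨L.act a, L.act (star a), L.inner_act a⟩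
  map_smul' c a := Subtype.ext (map_smul L.act c a)
  map_zero' := Subtype.ext (map_zero L.act)
  map_add' a b := Subtype.ext (map_add L.act a b)
  map_mul' a b := Subtype.ext (map_mul L.act a b)
  map_star' a := HilbertModule.Adjointable.eq_of_inner fun x y => by
    rw [← HilbertModule.Adjointable.inner_left]
    exact (L.inner_act a x y).symm

/-! ### Descent of homomorphisms and left actions to quotients -/

namespace ClosedIdeal

variable {A : Type*} [NonUnitalCStarAlgebra A] (I : ClosedIdeal A)

/-- An algebra homomorphism that vanishes on an ideal descends to the quotient. -/
def lift {R : Type*} [NonUnitalRing R] [Module ℂ R] (f : A →ₙₐ[ℂ] R)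
    (hf : ∀ a ∈ I.toSubmodule, f a = 0) : I.Quotient →ₙₐ[ℂ] R where
  __ := (I.toSubmodule.liftQ (f : A →ₗ[ℂ] R) fun a ha => hf a ha : A ⧸ I.toSubmodule →ₗ[ℂ] R)
  map_zero' := map_zero (I.toSubmodule.liftQ (f : A →ₗ[ℂ] R) fun a ha => hf a ha)
  map_mul' x y := by
    obtain ⟨a, rfl⟩ := I.mkL_surjective x
    obtain ⟨b, rfl⟩ := I.mkL_surjective y
    exact map_mul f a b

/-- A star-homomorphism that vanishes on an ideal descends to the quotient. -/
def liftStar {C : Type*} [NonUnitalCStarAlgebra C] (f : A →⋆ₙₐ[ℂ] C)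
    (hf : ∀ a ∈ I.toSubmodule, f a = 0) : I.Quotient →⋆ₙₐ[ℂ] C where
  __ := I.lift (f : A →ₙₐ[ℂ] C) hf
  map_star' x := by
    obtain ⟨a, rfl⟩ := I.mkL_surjective x
    exact map_star f a

end ClosedIdeal

theorem NonUnitalStarAlgHom.continuous_of_cstar {A C : Type*} [NonUnitalCStarAlgebra A]
    [NonUnitalCStarAlgebra C] (f : A →⋆ₙₐ[ℂ] C) : Continuous f :=
  AddMonoidHomClass.continuous_of_bound f 1 fun x => by
    rw [one_mul]; exact NonUnitalStarAlgHom.norm_apply_le f x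

/-- The kernel of a star-homomorphism. -/
def ClosedIdeal.ker {A C : Type*} [NonUnitalCStarAlgebra A] [NonUnitalCStarAlgebra C]
    (f : A →⋆ₙₐ[ℂ] C) : ClosedIdeal A where
  __ := LinearMap.ker (f : A →ₗ[ℂ] C)
  mul_mem_left a b hb := (map_mul f a b).trans (by rw [show f b = 0 from hb, mul_zero])
  mul_mem_right a b ha := (map_mul f a b).trans (by rw [show f a = 0 from ha, zero_mul])
  star_mem a ha := (map_star f a).trans (by rw [show f a = 0 from ha, star_zero])
  isClosed := isClosed_singleton.preimage f.continuous_of_cstar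

/-- The distance of `a` to the kernel of a star-homomorphism is the norm of the image of `a`. -/
theorem NonUnitalStarAlgHom.exists_norm_sub_lt {A C : Type*} [NonUnitalCStarAlgebra A]
    [NonUnitalCStarAlgebra C] (f : A →⋆ₙₐ[ℂ] C) (a : A) {ε : ℝ} (hε : 0 < ε) :
    ∃ b, f b = 0 ∧ ‖a - b‖ < ‖f a‖ + ε := by
  let J := ClosedIdeal.ker f
  -- The induced map on the quotient by the kernel is an injective star-homomorphism, hence
  -- isometric. So the quotient norm of `a`, its distance to the kernel, equals `‖f a‖`.
  let g := J.liftStar f fun a ha => ha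
  have hg : Function.Injective g := (injective_iff_map_eq_zero g).2 fun x hx => by
    obtain ⟨a, rfl⟩ := J.proj_surjective x
    exact (J.proj_eq_zero_iff a).2 hx
  obtain ⟨c, hc, hn⟩ := J.exists_mkL_eq (J.proj a) hε
  have h := NonUnitalStarAlgHom.norm_map g hg (J.proj a)
  refine ⟨a - c, J.mkL_eq_iff.1 hc.symm, ?_⟩
  rw [sub_sub_cancel]
  rwa [← h] at hn

theorem LeftAction.continuous_act {A B : Type*} [NonUnitalCStarAlgebra A]
    [NonUnitalCStarAlgebra B] {X : HilbertModule B} (L : LeftAction A X) : Continuous L.act :=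
  AddMonoidHomClass.continuous_of_bound L.act 1 fun a => by
    rw [one_mul]
    exact ContinuousLinearMap.opNorm_le_bound _ (norm_nonneg _) (L.norm_act_le a)

theorem LeftAction.ext {A B : Type*} [NonUnitalCStarAlgebra A] [NonUnitalCStarAlgebra B]
    {X : HilbertModule B} {L M : LeftAction A X} (h : ∀ a, L.act a = M.act a) : L = M := by
  obtain ⟨l, _, _⟩ := L
  obtain ⟨m, _, _⟩ := M
  obtain rfl : l = m := NonUnitalAlgHom.ext h
  rfl

/-- A left action that vanishes on an ideal descends to the quotient. -/
def LeftAction.descend {A B : Type*} [NonUnitalCStarAlgebra A] [NonUnitalCStarAlgebra B]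
    {X : HilbertModule B} (L : LeftAction A X) (I : ClosedIdeal A)
    (hL : ∀ a ∈ I.toSubmodule, L.act a = 0) : LeftAction I.Quotient X where
  act := I.lift L.act hL
  inner_act a x y := by
    obtain ⟨a, rfl⟩ := I.proj_surjective a
    exact L.inner_act a x y
  nondegenerate := L.nondegenerate.mono <| Submodule.span_mono <| by
    rintro _ ⟨a, x, rfl⟩
    exact ⟨I.proj a, x, rfl⟩

/-- The left action obtained by composition with a surjective homomorphism. -/
def LeftAction.comp {A A' B : Type*} [NonUnitalCStarAlgebra A] [NonUnitalCStarAlgebra A']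
    [NonUnitalCStarAlgebra B] {X : HilbertModule B} (L : LeftAction A' X) (f : A →⋆ₙₐ[ℂ] A')
    (hf : Function.Surjective f) : LeftAction A X where
  act := L.act.comp (f : A →ₙₐ[ℂ] A')
  inner_act a x y := (L.inner_act (f a) x y).trans <| by
    rw [← map_star]; rfl
  nondegenerate := L.nondegenerate.mono <| Submodule.span_mono <| by
    rintro _ ⟨a, x, rfl⟩
    obtain ⟨a, rfl⟩ := hf a
    exact ⟨a, x, rfl⟩

/-! ### Maps of Hilbert modules over a quotient homomorphism -/

namespace HilbertModule

variable {A : Type*} [NonUnitalCStarAlgebra A] {I : ClosedIdeal A} {X : HilbertModule A}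
  {Y : HilbertModule I.Quotient} {U : X →L[ℂ] Y}

/-- A map of Hilbert modules over a quotient map is, up to a small error, isometric after a change
by an element of `X · I`. -/
theorem exists_norm_sub_rsmul_lt (hU : ∀ x y, Y.inner (U x) (U y) = I.proj (X.inner x y)) (x : X)
    {ε : ℝ} (hε : 0 < ε) : ∃ e ∈ I.toSubmodule, ‖x - X.rsmul x e‖ < ‖U x‖ + ε := by
  -- With `c = ⟨x, x⟩`, let `b` be a lift of `π c` of almost minimal norm, and let `e ∈ I` be an
  -- approximate unit for `b - c ∈ I`. Then `‖x - x e‖² = ‖(1 - e) c (1 - e)‖ ≤ ‖(1 - e) c‖ < ‖b‖ +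
  -- ε² / 2 < ‖U x‖² + ε²`. The tolerance is `ε²` because norms are compared through their squares.
  obtain ⟨b, hb, hb'⟩ := I.exists_mkL_eq (I.mkL (X.inner x x)) (half_pos (pow_pos hε 2))
  have hi := I.mkL_eq_iff.1 hb
  obtain ⟨e, heI, hes, hec, hei⟩ := I.exists_approx _ hi (half_pos (pow_pos hε 2))
  refine ⟨e, heI, ?_⟩
  set c := X.inner x x with hc
  set z := c - e * c with hz
  have h2 : X.inner (x - X.rsmul x e) (x - X.rsmul x e) = z - z * e := by
    simp only [map_sub, LinearMap.sub_apply, X.inner_rsmul, X.inner_rsmul_left, hes, ← hc, hz]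
    noncomm_ring
  have h3 : ‖z - z * e‖ ≤ ‖z‖ := by
    have := hec (star z)
    rwa [norm_star, ← norm_star (star z - e * star z), star_sub, star_mul, star_star, hes] at this
  have h4 : z = (b - e * b) - ((b - c) - e * (b - c)) := by
    rw [hz]; noncomm_ring
  have h5 : ‖z‖ < ‖I.mkL c‖ + ε ^ 2 := by
    rw [h4]
    refine (norm_sub_le _ _).trans_lt ?_
    linarith [hec b]
  have h6 : ‖U x‖ ^ 2 = ‖I.mkL c‖ := by
    rw [Y.norm_sq, hU]; rfl
  refine lt_of_pow_lt_pow_left₀ 2 (by positivity) ?_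
  rw [X.norm_sq, h2]
  have : 0 ≤ ‖U x‖ * ε := by positivity
  nlinarith

theorem map_rsmul_eq_zero (hU : ∀ x y, Y.inner (U x) (U y) = I.proj (X.inner x y)) (x : X)
    {a : A} (ha : a ∈ I.toSubmodule) : U (X.rsmul x a) = 0 := by
  rw [map_rsmul_of_inner hU, (I.proj_eq_zero_iff a).2 ha, map_zero]

/-- If `U x = 0`, then `exists_norm_sub_rsmul_lt` gives `x · e` within `ε` of `x`, with `e ∈ I`. -/
theorem map_eq_zero_iff (hU : ∀ x y, Y.inner (U x) (U y) = I.proj (X.inner x y)) (x : X) :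
    U x = 0 ↔ x ∈ (Submodule.span ℂ
      {y | ∃ z, ∃ a ∈ I.toSubmodule, y = X.rsmul z a}).topologicalClosure := by
  constructor
  · intro h
    refine Metric.mem_closure_iff.2 fun ε hε => ?_
    obtain ⟨e, he, hn⟩ := exists_norm_sub_rsmul_lt hU x hε
    rw [h, norm_zero, zero_add] at hn
    exact ⟨X.rsmul x e, Submodule.subset_span ⟨x, e, he, rfl⟩, by rwa [dist_eq_norm]⟩
  · intro h
    refine (Submodule.topologicalClosure_minimal (t := LinearMap.ker U.toLinearMap) _
      (Submodule.span_le.2 ?_) U.isClosed_ker) h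
    rintro _ ⟨z, a, ha, rfl⟩
    exact map_rsmul_eq_zero hU z ha

theorem exists_map_eq_norm_le (hU : ∀ x y, Y.inner (U x) (U y) = I.proj (X.inner x y)) (x : X)
    {ε : ℝ} (hε : 0 < ε) : ∃ x', U x' = U x ∧ ‖x'‖ ≤ ‖U x‖ + ε := by
  obtain ⟨e, he, hn⟩ := exists_norm_sub_rsmul_lt hU x hε
  exact ⟨_, by rw [map_sub, map_rsmul_eq_zero hU x he, sub_zero], hn.le⟩

/-- A dense range suffices because it is closed: its vectors lift with norm control, and corrections
by successive lifts converge in the complete module `X`. -/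
theorem surjective_of_inner (hU : ∀ x y, Y.inner (U x) (U y) = I.proj (X.inner x y))
    (hd : DenseRange U) : Function.Surjective U := by
  let f : NormedAddGroupHom X Y := U.toLinearMap.toAddMonoidHom.mkNormedAddGroupHom 1 fun x => by
    rw [one_mul]; exact norm_map_le_of_inner hU x
  have h := controlled_closure_of_complete (f := f) (K := f.range) two_pos one_pos <| by
    rintro _ ⟨x, rfl⟩
    change ∃ g, U g = U x ∧ ‖g‖ ≤ 2 * ‖U x‖
    rcases eq_or_ne (U x) 0 with h0 | h0
    · exact ⟨0, by rw [h0, map_zero], by rw [norm_zero]; positivity⟩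
    -- The error allowed is `‖U x‖` itself, whence the constant 2.
    · obtain ⟨x', hx, hn⟩ := exists_map_eq_norm_le hU x (norm_pos_iff.2 h0)
      exact ⟨x', hx, hn.trans_eq (two_mul _).symm⟩
  intro y
  obtain ⟨x, hx, -⟩ := h y (hd y)
  exact ⟨x, hx⟩

/-- The value `S y` can be computed on a lift of `y` of almost the same norm. The excess `δ / (‖T‖ +
1)` in the norm of the lift costs at most `δ`; the summand 1 covers `T = 0`. -/
theorem norm_le_of_intertwine (hU : ∀ x y, Y.inner (U x) (U y) = I.proj (X.inner x y))
    (hs : Function.Surjective U) {T : X →L[ℂ] X} {S : Y →L[ℂ] Y} (h : ∀ x, S (U x) = U (T x)) :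
    ‖S‖ ≤ ‖T‖ := by
  refine ContinuousLinearMap.opNorm_le_bound _ (norm_nonneg _) fun y => ?_
  obtain ⟨x, rfl⟩ := hs y
  refine le_of_forall_pos_le_add fun δ hδ => ?_
  obtain ⟨x', hx, hn⟩ := exists_map_eq_norm_le hU x
    (div_pos hδ (by positivity : 0 < ‖T‖ + 1))
  rw [← hx, h, hx]
  calc ‖U (T x')‖ ≤ ‖T x'‖ := norm_map_le_of_inner hU _
    _ ≤ ‖T‖ * ‖x'‖ := T.le_opNorm _
    _ ≤ ‖T‖ * (‖U x‖ + δ / (‖T‖ + 1)) := by gcongr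
    _ ≤ ‖T‖ * ‖U x‖ + δ := by
      rw [mul_add]
      gcongr
      rw [mul_div_assoc', div_le_iff₀ (by positivity)]
      nlinarith [norm_nonneg T]

/-- Compact operators on `X` induce compact operators on the quotient module. -/
theorem exists_compactOperators_map (hU : ∀ x y, Y.inner (U x) (U y) = I.proj (X.inner x y))
    (hs : Function.Surjective U) :
    ∃ κ : X.compactOperators →L[ℂ] Y.compactOperators,
      (∀ x y, κ (X.compactRankOne x y) = Y.compactRankOne (U x) (U y)) ∧
      ∀ T x, (κ T).1 (U x) = U (T.1 x) := by
  have : CompleteSpace Y.compactOperators :=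
    (Submodule.isClosed_topologicalClosure _).completeSpace_coe
  obtain ⟨κ, hκ⟩ := X.exists_compactOperators_hom
    (fun p => Y.compactRankOne (U p.1) (U p.2)) fun t => by
      refine (norm_le_of_intertwine hU hs
        (S := ((Finsupp.linearCombination ℂ fun p : X × X =>
          Y.compactRankOne (U p.1) (U p.2)) t : Y.compactOperators).1) fun x => ?_)
      simp [Finsupp.linearCombination_apply, Finsupp.sum, compactRankOne, map_rankOne_of_inner hU]
  refine ⟨κ, hκ, fun T x => ?_⟩
  -- Both sides of the intertwining identity are bounded and linear in `T`, so rank-one operators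
  -- suffice.
  let ev : X.compactOperators →L[ℂ] Y :=
    U.comp ((ContinuousLinearMap.apply ℂ X x).comp X.compactOperators.subtypeL)
  let ev' : X.compactOperators →L[ℂ] Y :=
    (ContinuousLinearMap.apply ℂ Y (U x)).comp (Y.compactOperators.subtypeL.comp κ)
  refine DFunLike.congr_fun (compactOperators_hom_ext (f := ev') (g := ev) fun z w => ?_) T
  change (κ (X.compactRankOne z w)).1 (U x) = U (X.rankOne z w x)
  rw [hκ, map_rankOne_of_inner hU]
  rfl

end HilbertModule

theorem Submodule.dense_span_range_comp {V W ι : Type*} [NormedAddCommGroup V] [NormedSpace ℂ V]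
    [NormedAddCommGroup W] [NormedSpace ℂ W] (f : V →L[ℂ] W) (hf : Function.Surjective f)
    (g : ι → V) (hg : Dense (Submodule.span ℂ (Set.range g) : Set V)) :
    Dense (Submodule.span ℂ (Set.range fun i => f (g i)) : Set W) := by
  have h := hf.denseRange.dense_image f.continuous hg
  rw [← ContinuousLinearMap.coe_coe, ← Submodule.map_coe, Submodule.map_span, ← Set.range_comp] at h
  exact h

/-- This is the case `I = A` of `exists_norm_sub_rsmul_lt`: the quotient algebra is zero, so the
zero map respects inner products, and every `x` is within `ε` of some `x · e`. -/
theorem HilbertModule.dense_span_rsmul {A : Type*} [NonUnitalCStarAlgebra A]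
    (X : HilbertModule A) :
    Dense (Submodule.span ℂ (Set.range fun p : X × A => X.rsmul p.1 p.2) : Set X) := by
  let I : ClosedIdeal A :=
    { (⊤ : Submodule ℂ A) with
      mul_mem_left := fun _ _ _ => trivial
      mul_mem_right := fun _ _ _ => trivial
      star_mem := fun _ _ => trivial
      isClosed := isClosed_univ }
  have hU : ∀ x y : X, (HilbertModule.self I.Quotient).inner
      ((0 : X →L[ℂ] HilbertModule.self I.Quotient) x)
      ((0 : X →L[ℂ] HilbertModule.self I.Quotient) y) = I.proj (X.inner x y) := fun x y => by
    rw [(I.proj_eq_zero_iff _).2 trivial, zero_apply, map_zero, LinearMap.zero_apply]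
  refine fun x => Metric.mem_closure_iff.2 fun ε hε => ?_
  obtain ⟨e, -, h⟩ := HilbertModule.exists_norm_sub_rsmul_lt hU x hε
  refine ⟨_, Submodule.subset_span ⟨(x, e), rfl⟩, ?_⟩
  rwa [zero_apply, norm_zero, zero_add, ← dist_eq_norm] at h

namespace Correspondence

variable {A B C : Type*} [NonUnitalCStarAlgebra A] [NonUnitalCStarAlgebra B]
  [NonUnitalCStarAlgebra C]

theorem act_rsmul (X : Correspondence A B) (a : A) (x : X) (b : B) :
    X.act a (X.rsmul x b) = X.rsmul (X.act a x) b :=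
  HilbertModule.Adjointable.map_rsmul (X.left.toAdjointable a) x b

theorem Iso.norm_map {X Y : Correspondence A B} (e : X.Iso Y) (x : X) : ‖e x‖ = ‖x‖ := by
  rw [X.toHilbertModule.norm_eq, Y.toHilbertModule.norm_eq]
  exact congrArg (fun b => √‖b‖) (e.map_inner x x)

/-- An isomorphism of correspondences as a bounded linear map. -/
noncomputable def Iso.toCLM {X Y : Correspondence A B} (e : X.Iso Y) : X →L[ℂ] Y :=
  e.toLinearEquiv.toLinearMap.mkContinuous 1 fun x => by
    rw [one_mul]; exact (e.norm_map x).le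

theorem dense_span_range_tmul (X : Correspondence A B) (Y : Correspondence B C) :
    Dense (Submodule.span ℂ (Set.range fun p : X × Y => X.tmul Y p.1 p.2) :
      Set (X.tensor Y)) := by
  refine (X.dense_span_tmul Y).mono (Submodule.span_mono ?_)
  rintro _ ⟨x, y, rfl⟩
  exact ⟨(x, y), rfl⟩

end Correspondence

/-! ### Invariance of the kernel ideal and the quotient product system -/

namespace ProductSystem

variable {P A : Type*} [Monoid P] [NonUnitalCStarAlgebra A] {E : P → Correspondence A A}
  (𝓔 : ProductSystem E) (hP : IsRightOre P)

theorem subset_kernelIdeal {p : P} {a : A} (h : (E p).act a = 0) :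
    a ∈ (𝓔.kernelIdeal hP).toSubmodule :=
  subset_closure (Set.mem_iUnion.2 ⟨p, h⟩)

theorem tensor_act_eq_zero_iff (𝓔 : ProductSystem E) (p q : P) (a : A) :
    ((E p).tensor (E q)).act a = 0 ↔ (E (p * q)).act a = 0 := by
  constructor
  · intro h
    ext z
    obtain ⟨t, rfl⟩ := (𝓔.mul p q).toLinearEquiv.surjective z
    rw [← (𝓔.mul p q).map_act, h]
    simp
  · intro h
    ext t
    refine (𝓔.mul p q).toLinearEquiv.injective ?_
    rw [(𝓔.mul p q).map_act, h]
    simp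

/-- Invariance of `I`, which is what makes the left action of `A` on `E'_p` descend to `A'`. The
identity `⟨x ⊗ z, a y ⊗ w⟩ = ⟨z, ⟨x, a y⟩ w⟩` in `E_p ⊗ E_s` turns vanishing of `a` on `E_(ps)` into
vanishing of `⟨x, a y⟩` on `E_s`. -/
theorem inner_act_mem_kernelIdeal {p : P} (x y : E p) {a : A}
    (ha : a ∈ (𝓔.kernelIdeal hP).toSubmodule) :
    (E p).inner x ((E p).act a y) ∈ (𝓔.kernelIdeal hP).toSubmodule := by
  have hc : Continuous fun a => (E p).inner x ((E p).act a y) :=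
    ((E p).toHilbertModule.innerL x).continuous.comp
      ((ContinuousLinearMap.apply ℂ (E p) y).continuous.comp (E p).left.continuous_act)
  refine closure_minimal (t := (fun a => (E p).inner x ((E p).act a y)) ⁻¹'
    ((𝓔.kernelIdeal hP).toSubmodule : Set A)) ?_ ((𝓔.kernelIdeal hP).isClosed.preimage hc) ha
  intro a ha
  obtain ⟨r, hr⟩ := Set.mem_iUnion.1 ha
  -- Vanishing on `E_r` persists on `E_(rt)`, and `t` is chosen so that `r * t` is also a right
  -- multiple of `p`.
  obtain ⟨s, t, hst⟩ := hP.exists_mul_eq_mul p r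
  have h1 := 𝓔.act_mul_eq_zero hr t
  rw [← hst, ← 𝓔.tensor_act_eq_zero_iff] at h1
  refine 𝓔.subset_kernelIdeal hP (p := s) ?_
  ext w
  refine (E s).toHilbertModule.eq_of_inner_left_eq fun z => ?_
  have h2 := (E p).toHilbertModule.inner_tmul (E s) x ((E p).act a y) z w
  refine h2.symm.trans ?_
  have h3 := (E p).act_tmul (E s) a y w
  rw [h1] at h3
  rw [zero_apply, map_zero]
  exact (congrArg _ h3.symm).trans (map_zero _)

/-- The vectors `x · a` span a dense subspace, and `⟨x ⊗ π a, y ⊗ π b⟩ = π(a)* π⟨x, y⟩ π(b) = π ⟨x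
a, y b⟩`. The compatibility with inner products is the property on which most later arguments rest.
-/
theorem exists_fibreMap (p : P) : ∃ q : E p →L[ℂ] 𝓔.quotientFibre hP p,
    (∀ x a, q ((E p).rsmul x a) = 𝓔.quotientTmul hP p x (𝓔.quotientMap hP a)) ∧
    ∀ x y, (𝓔.quotientFibre hP p).inner (q x) (q y) = 𝓔.quotientMap hP ((E p).inner x y) := by
  obtain ⟨q, hq, hq'⟩ := HilbertModule.exists_continuousLinearMap (X := (E p).toHilbertModule)
    (Y := 𝓔.quotientFibre hP p) (𝓔.quotientMap hP) (fun t : E p × A => (E p).rsmul t.1 t.2)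
    (fun t => 𝓔.quotientTmul hP p t.1 (𝓔.quotientMap hP t.2))
    (E p).toHilbertModule.dense_span_rsmul fun s t => by
      refine ((E p).toHilbertModule.inner_tmul (𝓔.quotientCorrespondence hP) _ _ _ _).trans ?_
      rw [(E p).toHilbertModule.inner_rsmul, (E p).toHilbertModule.inner_rsmul_left, _root_.mul_assoc,
        map_mul, map_mul, map_star]
      rfl
  exact ⟨q, fun x a => hq (x, a), hq'⟩

/-- The quotient map `E_p → E'_p`. -/
noncomputable def fibreMap (p : P) : E p →L[ℂ] 𝓔.quotientFibre hP p :=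
  (𝓔.exists_fibreMap hP p).choose

theorem fibreMap_rsmul (p : P) (x : E p) (a : A) : 𝓔.fibreMap hP p ((E p).rsmul x a)
    = 𝓔.quotientTmul hP p x (𝓔.quotientMap hP a) :=
  (𝓔.exists_fibreMap hP p).choose_spec.1 x a

theorem inner_fibreMap (p : P) (x y : E p) :
    (𝓔.quotientFibre hP p).inner (𝓔.fibreMap hP p x) (𝓔.fibreMap hP p y)
      = 𝓔.quotientMap hP ((E p).inner x y) :=
  (𝓔.exists_fibreMap hP p).choose_spec.2 x y

theorem fibreMap_surjective (p : P) : Function.Surjective (𝓔.fibreMap hP p) := by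
  refine HilbertModule.surjective_of_inner (𝓔.inner_fibreMap hP p) fun y => ?_
  refine closure_mono (s := (Submodule.span ℂ {t : 𝓔.quotientFibre hP p | ∃ x b,
    t = 𝓔.quotientTmul hP p x b} : Set (𝓔.quotientFibre hP p))) ?_
    ((E p).toHilbertModule.dense_span_tmul (𝓔.quotientCorrespondence hP) y)
  refine Submodule.span_le (p := LinearMap.range (𝓔.fibreMap hP p).toLinearMap).2 ?_
  rintro _ ⟨x, b, rfl⟩
  obtain ⟨a, rfl⟩ := (𝓔.kernelIdeal hP).proj_surjective b
  exact ⟨_, 𝓔.fibreMap_rsmul hP p x a⟩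

/-- A linear map on `E_p` that vanishes on the kernel of the quotient map descends to `E'_p`. -/
noncomputable def fibreLift (p : P) {V : Type*} [AddCommGroup V] [Module ℂ V] (f : E p →ₗ[ℂ] V)
    (hf : ∀ x, 𝓔.fibreMap hP p x = 0 → f x = 0) : 𝓔.quotientFibre hP p →ₗ[ℂ] V :=
  ((LinearMap.ker (𝓔.fibreMap hP p).toLinearMap).liftQ f fun x hx => hf x hx).comp
    ((𝓔.fibreMap hP p).toLinearMap.quotKerEquivOfSurjective
      (𝓔.fibreMap_surjective hP p)).symm.toLinearMap

theorem fibreLift_fibreMap (p : P) {V : Type*} [AddCommGroup V] [Module ℂ V] (f : E p →ₗ[ℂ] V)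
    (hf : ∀ x, 𝓔.fibreMap hP p x = 0 → f x = 0) (x : E p) :
    𝓔.fibreLift hP p f hf (𝓔.fibreMap hP p x) = f x := by
  have h : ((𝓔.fibreMap hP p).toLinearMap.quotKerEquivOfSurjective
      (𝓔.fibreMap_surjective hP p)).symm (𝓔.fibreMap hP p x) = Submodule.Quotient.mk x := by
    rw [LinearEquiv.symm_apply_eq]; rfl
  exact congrArg _ h

theorem act_fibreMap (p : P) (a : A) (x : E p) :
    ((E p).tensor (𝓔.quotientCorrespondence hP)).act a (𝓔.fibreMap hP p x)
      = 𝓔.fibreMap hP p ((E p).act a x) := by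
  let f : E p →L[ℂ] 𝓔.quotientFibre hP p :=
    (((E p).tensor (𝓔.quotientCorrespondence hP)).act a).comp (𝓔.fibreMap hP p)
  let g : E p →L[ℂ] 𝓔.quotientFibre hP p := (𝓔.fibreMap hP p).comp ((E p).act a)
  refine DFunLike.congr_fun (f := f) (g := g)
    (ContinuousLinearMap.ext_on (E p).toHilbertModule.dense_span_rsmul ?_) x
  rintro _ ⟨⟨x, b⟩, rfl⟩
  change ((E p).tensor (𝓔.quotientCorrespondence hP)).act a
    (𝓔.fibreMap hP p ((E p).rsmul x b)) = 𝓔.fibreMap hP p ((E p).act a ((E p).rsmul x b))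
  rw [fibreMap_rsmul, Correspondence.act_rsmul, fibreMap_rsmul]
  exact (E p).act_tmul _ a x _

theorem fibreMap_eq_zero_iff_inner (p : P) (x : E p) :
    𝓔.fibreMap hP p x = 0 ↔ (E p).inner x x ∈ (𝓔.kernelIdeal hP).toSubmodule := by
  rw [← (𝓔.kernelIdeal hP).proj_eq_zero_iff, ← 𝓔.inner_fibreMap hP p]
  refine ⟨fun h => by rw [h, map_zero], (𝓔.quotientFibre hP p).eq_zero_of_inner_self_eq_zero⟩

/-- For `a ∈ I`, invariance gives `⟨a x, a x⟩ ∈ I`, that is, `q_p (a x) = 0`, and `q_p` is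
surjective. -/
theorem tensor_quotient_act_eq_zero (p : P) {a : A} (ha : a ∈ (𝓔.kernelIdeal hP).toSubmodule) :
    ((E p).tensor (𝓔.quotientCorrespondence hP)).left.act a = 0 := by
  ext y
  obtain ⟨x, rfl⟩ := 𝓔.fibreMap_surjective hP p y
  exact (𝓔.act_fibreMap hP p a x).trans
    ((𝓔.fibreMap_eq_zero_iff_inner hP p _).2 (𝓔.inner_act_mem_kernelIdeal hP _ _ ha))

/-- The left action of `A'` on `E'_p`. -/
noncomputable def quotientLeft (p : P) : LeftAction (𝓔.QuotientAlgebra hP) (𝓔.quotientFibre hP p) :=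
  ((E p).tensor (𝓔.quotientCorrespondence hP)).left.descend (𝓔.kernelIdeal hP)
    fun _ => 𝓔.tensor_quotient_act_eq_zero hP p

theorem quotientLeft_act_fibreMap (p : P) (a : A) (x : E p) :
    (𝓔.quotientLeft hP p).act (𝓔.quotientMap hP a) (𝓔.fibreMap hP p x)
      = 𝓔.fibreMap hP p ((E p).act a x) := 𝓔.act_fibreMap hP p a x

/-- The families `q x ⊗ q y` and `q (x y)` both have the inner products `π ⟨y, ⟨x, x'⟩ y'⟩` and both
span dense subspaces, so a unitary maps one to the other. -/
theorem exists_quotientMul (p r : P) :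
    ∃ e : ((𝓔.quotientFibres hP (𝓔.quotientLeft hP) p).tensor
        (𝓔.quotientFibres hP (𝓔.quotientLeft hP) r)).Iso
        (𝓔.quotientFibres hP (𝓔.quotientLeft hP) (p * r)),
      ∀ x y, e ((𝓔.quotientFibres hP (𝓔.quotientLeft hP) p).tmul
        (𝓔.quotientFibres hP (𝓔.quotientLeft hP) r) (𝓔.fibreMap hP p x) (𝓔.fibreMap hP r y))
        = 𝓔.fibreMap hP (p * r) (𝓔.mul p r ((E p).tmul (E r) x y)) := by
  let X := 𝓔.quotientFibres hP (𝓔.quotientLeft hP) p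
  let Y := 𝓔.quotientFibres hP (𝓔.quotientLeft hP) r
  let Z := 𝓔.quotientFibres hP (𝓔.quotientLeft hP) (p * r)
  let f : E p × E r → X.tensor Y := fun t => X.tmul Y (𝓔.fibreMap hP p t.1) (𝓔.fibreMap hP r t.2)
  let g : E p × E r → Z := fun t =>
    𝓔.fibreMap hP (p * r) (𝓔.mul p r ((E p).tmul (E r) t.1 t.2))
  have hf : Dense (Submodule.span ℂ (Set.range f) : Set (X.tensor Y)) := by
    refine (X.dense_span_tmul Y).mono (Submodule.span_mono ?_)
    rintro _ ⟨x, y, rfl⟩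
    obtain ⟨x, rfl⟩ := 𝓔.fibreMap_surjective hP p x
    obtain ⟨y, rfl⟩ := 𝓔.fibreMap_surjective hP r y
    exact ⟨(x, y), rfl⟩
  have hg : Dense (Submodule.span ℂ (Set.range g) : Set Z) :=
    Submodule.dense_span_range_comp ((𝓔.fibreMap hP (p * r)).comp (𝓔.mul p r).toCLM)
      ((𝓔.fibreMap_surjective hP (p * r)).comp (𝓔.mul p r).toLinearEquiv.surjective) _
      ((E p).dense_span_range_tmul (E r))
  obtain ⟨e, he, hr, hi, hc⟩ := HilbertModule.exists_unitary (X := (X.tensor Y).toHilbertModule)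
    (Y := Z.toHilbertModule) f g hf hg fun s t => by
      refine (𝓔.inner_fibreMap hP (p * r) _ _).trans ?_
      refine Eq.trans ?_ (X.toHilbertModule.inner_tmul Y _ _ _ _).symm
      rw [(𝓔.mul p r).map_inner]
      refine (congrArg _ ((E p).toHilbertModule.inner_tmul (E r) _ _ _ _)).trans ?_
      rw [← 𝓔.inner_fibreMap hP r, ← quotientLeft_act_fibreMap]
      congr 3
      exact (𝓔.inner_fibreMap hP p _ _).symm
  refine ⟨⟨e, fun a t => ?_, hr, hi⟩, fun x y => he (x, y)⟩
  obtain ⟨a, rfl⟩ := (𝓔.kernelIdeal hP).proj_surjective a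
  let e' : X.tensor Y →L[ℂ] Z := ⟨e.toLinearMap, hc⟩
  refine DFunLike.congr_fun (f := e'.comp ((X.tensor Y).act (𝓔.quotientMap hP a)))
    (g := (Z.act (𝓔.quotientMap hP a)).comp e') (ContinuousLinearMap.ext_on hf ?_) t
  rintro _ ⟨⟨x, y⟩, rfl⟩
  change e ((X.tensor Y).act (𝓔.quotientMap hP a)
    (X.tmul Y (𝓔.fibreMap hP p x) (𝓔.fibreMap hP r y)))
    = Z.act (𝓔.quotientMap hP a) (e (f (x, y)))
  rw [he, X.act_tmul, 𝓔.quotientLeft_act_fibreMap hP p]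
  refine (he ((E p).act a x, y)).trans ?_
  refine Eq.trans ?_ (𝓔.quotientLeft_act_fibreMap hP (p * r) a _).symm
  rw [← (𝓔.mul p r).map_act]
  exact congrArg (fun t => 𝓔.fibreMap hP (p * r) (𝓔.mul p r t)) ((E p).act_tmul (E r) a x y).symm

theorem exists_quotientUnit :
    ∃ e : (Correspondence.self (𝓔.QuotientAlgebra hP)).Iso
        (𝓔.quotientFibres hP (𝓔.quotientLeft hP) 1),
      ∀ a, e (𝓔.quotientMap hP a) = 𝓔.fibreMap hP 1 (𝓔.unit a) := by
  let X := Correspondence.self (𝓔.QuotientAlgebra hP)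
  let Z := 𝓔.quotientFibres hP (𝓔.quotientLeft hP) 1
  let f : A → X := 𝓔.quotientMap hP
  let g : A → Z := fun a => 𝓔.fibreMap hP 1 (𝓔.unit a)
  have hfs : Function.Surjective f := (𝓔.kernelIdeal hP).proj_surjective
  have hgs : Function.Surjective g :=
    (𝓔.fibreMap_surjective hP 1).comp 𝓔.unit.toLinearEquiv.surjective
  obtain ⟨e, he, hr, hi, hc⟩ := HilbertModule.exists_unitary (X := X.toHilbertModule)
    (Y := Z.toHilbertModule) f g
    (by rw [hfs.range_eq, Submodule.span_univ]; exact dense_univ)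
    (by rw [hgs.range_eq, Submodule.span_univ]; exact dense_univ) fun s t => by
      refine (𝓔.inner_fibreMap hP 1 _ _).trans ?_
      refine (congrArg (𝓔.quotientMap hP) (𝓔.unit.map_inner s t)).trans ?_
      exact (map_mul (𝓔.quotientMap hP) _ _).trans
        (congrArg (· * 𝓔.quotientMap hP t) (map_star (𝓔.quotientMap hP) s))
  refine ⟨⟨e, fun a t => ?_, hr, hi⟩, he⟩
  obtain ⟨a, rfl⟩ := (𝓔.kernelIdeal hP).proj_surjective a
  obtain ⟨b, rfl⟩ := hfs t
  have h1 : X.act (𝓔.quotientMap hP a) (f b) = f (a * b) :=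
    (map_mul (𝓔.quotientMap hP) a b).symm
  rw [h1, he, he]
  refine Eq.trans ?_ (𝓔.quotientLeft_act_fibreMap hP 1 a _).symm
  exact congrArg (𝓔.fibreMap hP 1) (𝓔.unit.map_act a b)

/-- The quotient product system. -/
noncomputable def quotient : ProductSystem (𝓔.quotientFibres hP (𝓔.quotientLeft hP)) where
  unit := (𝓔.exists_quotientUnit hP).choose
  mul p r := (𝓔.exists_quotientMul hP p r).choose
  unit_mul r a y := by
    obtain ⟨a, rfl⟩ := (𝓔.kernelIdeal hP).proj_surjective a
    obtain ⟨y, rfl⟩ := 𝓔.fibreMap_surjective hP r y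
    rw [(𝓔.exists_quotientUnit hP).choose_spec a, (𝓔.exists_quotientMul hP 1 r).choose_spec,
      𝓔.quotientLeft_act_fibreMap hP r]
    -- Applying `q` fibrewise to the disjoint union of the fibres carries the identity for `E` to
    -- that for `E'`, without any transport along `1 * r = r`.
    exact congrArg (fun s : Σ p, E p => (⟨s.1, 𝓔.fibreMap hP s.1 s.2⟩ :
      Σ p, 𝓔.quotientFibres hP (𝓔.quotientLeft hP) p)) (𝓔.unit_mul r a y)
  mul_unit p x a := by
    obtain ⟨a, rfl⟩ := (𝓔.kernelIdeal hP).proj_surjective a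
    obtain ⟨x, rfl⟩ := 𝓔.fibreMap_surjective hP p x
    rw [(𝓔.exists_quotientUnit hP).choose_spec a, (𝓔.exists_quotientMul hP p 1).choose_spec]
    have h := HilbertModule.map_rsmul_of_inner (𝓔.inner_fibreMap hP p) x a
    refine Eq.trans ?_ (congrArg (fun y => (⟨p, y⟩ :
      Σ p, 𝓔.quotientFibres hP (𝓔.quotientLeft hP) p)) h)
    exact congrArg (fun s : Σ p, E p => (⟨s.1, 𝓔.fibreMap hP s.1 s.2⟩ :
      Σ p, 𝓔.quotientFibres hP (𝓔.quotientLeft hP) p)) (𝓔.mul_unit p x a)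
  mul_assoc p r s x y z := by
    obtain ⟨x, rfl⟩ := 𝓔.fibreMap_surjective hP p x
    obtain ⟨y, rfl⟩ := 𝓔.fibreMap_surjective hP r y
    obtain ⟨z, rfl⟩ := 𝓔.fibreMap_surjective hP s z
    rw [(𝓔.exists_quotientMul hP p r).choose_spec, (𝓔.exists_quotientMul hP r s).choose_spec,
      (𝓔.exists_quotientMul hP (p * r) s).choose_spec,
      (𝓔.exists_quotientMul hP p (r * s)).choose_spec]
    exact congrArg (fun s : Σ p, E p => (⟨s.1, 𝓔.fibreMap hP s.1 s.2⟩ :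
      Σ p, 𝓔.quotientFibres hP (𝓔.quotientLeft hP) p)) (𝓔.mul_assoc p r s x y z)

theorem quotient_unit (a : A) :
    (𝓔.quotient hP).unit (𝓔.quotientMap hP a) = 𝓔.fibreMap hP 1 (𝓔.unit a) :=
  (𝓔.exists_quotientUnit hP).choose_spec a

theorem quotient_mul (p r : P) (x : E p) (y : E r) :
    (𝓔.quotient hP).mul p r ((𝓔.quotientFibres hP (𝓔.quotientLeft hP) p).tmul
        (𝓔.quotientFibres hP (𝓔.quotientLeft hP) r) (𝓔.fibreMap hP p x) (𝓔.fibreMap hP r y))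
      = 𝓔.fibreMap hP (p * r) (𝓔.mul p r ((E p).tmul (E r) x y)) :=
  (𝓔.exists_quotientMul hP p r).choose_spec x y

end ProductSystem

/-! ### Properness and faithfulness of the quotient, through the operators `T ⊗ 1` -/

namespace HilbertModule.Adjointable

variable {B : Type*} [NonUnitalCStarAlgebra B] {X : HilbertModule B}

variable (X) in
/-- The operators `|x⟩⟨y|` as a bounded linear map in `x`. -/
noncomputable def rankOneL (y : X) : X →L[ℂ] X.adjointable :=
  (X.rankOneL y).codRestrict (Subalgebra.toSubmodule X.adjointable) fun x => (rankOne X x y).2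

end HilbertModule.Adjointable

namespace HilbertModule

variable {A B C : Type*} [NonUnitalCStarAlgebra A] [NonUnitalCStarAlgebra B]
  [NonUnitalCStarAlgebra C]

/-- The action of `𝔹(X)` on `X ⊗ Y`. -/
noncomputable def amplification (X : HilbertModule B) (Y : Correspondence B C) :
    Correspondence X.adjointable C :=
  (Adjointable.correspondence X).tensor Y

theorem amplification_act_tmul (X : HilbertModule B) (Y : Correspondence B C) (T : X.adjointable)
    (x : X) (y : Y) : (X.amplification Y).act T (X.tmul Y x y) = X.tmul Y (T.1 x) y :=
  (Adjointable.correspondence X).act_tmul Y T x y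

/-- The hypothesis at the coefficient `⟨T x, T x⟩` gives `⟨T x ⊗ y, T x ⊗ y⟩ = ⟨y, ⟨T x, T x⟩ y⟩ =
0`. -/
theorem amplification_act_eq_zero {X : HilbertModule B} {Y : Correspondence B C}
    {T : X.adjointable} (hT : ∀ x y, Y.act (X.inner x (T.1 y)) = 0) :
    (X.amplification Y).act T = 0 := by
  refine ContinuousLinearMap.ext_on
    ((Adjointable.correspondence X).dense_span_range_tmul Y) ?_
  rintro _ ⟨⟨x, y⟩, rfl⟩
  change X at x
  refine (amplification_act_tmul X Y T x y).trans ?_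
  refine (X.tensor Y).eq_zero_of_inner_self_eq_zero ?_
  rw [X.inner_tmul, hT, zero_apply, map_zero]

theorem amplification_act_toAdjointable (X : Correspondence A B) (Y : Correspondence B C) (a : A) :
    (X.toHilbertModule.amplification Y).act (X.left.toAdjointable a) = (X.tensor Y).act a := by
  refine ContinuousLinearMap.ext_on (X.dense_span_range_tmul Y) ?_
  rintro _ ⟨⟨x, y⟩, rfl⟩
  exact (amplification_act_tmul X.toHilbertModule Y _ x y).trans (X.act_tmul Y a x y).symm

end HilbertModule

namespace ProductSystem

open HilbertModule

variable {P A : Type*} [Monoid P] [NonUnitalCStarAlgebra A] {E : P → Correspondence A A}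
  (𝓔 : ProductSystem E) (hP : IsRightOre P)

theorem quotient_isProper {p : P} (h : (E p).IsProper) :
    (𝓔.quotientFibres hP (𝓔.quotientLeft hP) p).IsProper := by
  intro a
  obtain ⟨a, rfl⟩ := (𝓔.kernelIdeal hP).proj_surjective a
  obtain ⟨κ, -, hκ⟩ := exists_compactOperators_map (𝓔.inner_fibreMap hP p)
    (𝓔.fibreMap_surjective hP p)
  have e : (𝓔.quotientLeft hP p).act (𝓔.quotientMap hP a) = (κ ⟨(E p).act a, h a⟩).1 := by
    ext y
    obtain ⟨x, rfl⟩ := 𝓔.fibreMap_surjective hP p y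
    rw [quotientLeft_act_fibreMap, hκ]
  change (𝓔.quotientLeft hP p).act (𝓔.quotientMap hP a) ∈ _
  rw [e]
  exact (κ ⟨(E p).act a, h a⟩).2


/-- The adjointable operators `T` on `E_p` such that `T ⊗ 1` vanishes on `E_p ⊗ E_r` for
some `r`. -/
noncomputable def locallyZero (𝓔 : ProductSystem E) (hP : IsRightOre P) (p : P) :
    Submodule ℂ (E p).toHilbertModule.adjointable where
  -- Vanishing of `T ⊗ 1` is expressed by coefficients: `⟨x ⊗ v, T y ⊗ w⟩ = ⟨v, φ_r(⟨x, T y⟩) w⟩`.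
  carrier := {T | ∃ r, ∀ x y, (E r).act ((E p).inner x (T.1 y)) = 0}
  zero_mem' := ⟨1, fun x y => by
    rw [← map_zero (E 1).act]
    exact congrArg _ (map_zero ((E p).inner x))⟩
  add_mem' := by
    rintro S T ⟨r, hS⟩ ⟨s, hT⟩
    -- By the Ore condition, the two indices have a common right multiple, and vanishing persists
    -- there.
    obtain ⟨u, v, huv⟩ := hP.exists_mul_eq_mul r s
    refine ⟨r * u, fun x y => ?_⟩
    have h1 := 𝓔.act_mul_eq_zero (hS x y) u
    have h2 := 𝓔.act_mul_eq_zero (hT x y) v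
    rw [← huv] at h2
    change (E (r * u)).act ((E p).inner x (S.1 y + T.1 y)) = 0
    rw [map_add, map_add, h1, h2, add_zero]
  smul_mem' := by
    rintro c T ⟨r, hT⟩
    refine ⟨r, fun x y => ?_⟩
    change (E r).act ((E p).inner x (c • T.1 y)) = 0
    rw [map_smul, map_smul, hT, smul_zero]

/-- If `x = z · a` with `φ_r a = 0`, the coefficients `⟨v, z⟩ a ⟨y, w⟩` of `|x⟩⟨y|` lie in `ker
φ_r`. The general case follows by continuity, first in `a` and then in `x`. -/
theorem rankOne_mem_closure_locallyZero {p : P} {x : E p}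
    (hx : x ∈ (Submodule.span ℂ {y | ∃ z, ∃ a ∈ (𝓔.kernelIdeal hP).toSubmodule,
      y = (E p).rsmul z a}).topologicalClosure) (y : E p) :
    Adjointable.rankOne (E p).toHilbertModule x y
      ∈ (𝓔.locallyZero hP p).topologicalClosure := by
  let M := (𝓔.locallyZero hP p).topologicalClosure
  have hM : IsClosed (M : Set (E p).toHilbertModule.adjointable) :=
    Submodule.isClosed_topologicalClosure _
  let R := Adjointable.rankOneL (E p).toHilbertModule y
  refine (Submodule.topologicalClosure_minimal (t := M.comap R.toLinearMap) _
    (Submodule.span_le.2 ?_) (hM.preimage R.continuous)) hx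
  rintro _ ⟨z, a, ha, rfl⟩
  have hc : Continuous fun a => R ((E p).rsmul z a) :=
    R.continuous.comp ((E p).toHilbertModule.rsmulL z).continuous
  refine closure_minimal (t := (fun a => R ((E p).rsmul z a)) ⁻¹' (M : Set _)) ?_
    (hM.preimage hc) ha
  intro a ha
  obtain ⟨r, hr⟩ := Set.mem_iUnion.1 ha
  refine subset_closure ⟨r, fun v w => ?_⟩
  change (E r).act ((E p).inner v ((E p).rsmul ((E p).rsmul z a) ((E p).inner y w))) = 0
  rw [(E p).toHilbertModule.inner_rsmul, (E p).toHilbertModule.inner_rsmul, map_mul, map_mul,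
    show (E r).act a = 0 from hr, mul_zero, zero_mul]

/-- Under `E_p ⊗ E_r ≅ E_(pr)`, the action of `a` is `φ_p(a) ⊗ 1`. It equals `(φ_p(a) - T) ⊗ 1`
because `T ⊗ 1 = 0`, and amplification is contractive. -/
theorem norm_act_mul_le (𝓔 : ProductSystem E) {p r : P} (a : A)
    {T : (E p).toHilbertModule.adjointable}
    (hT : ∀ x y, (E r).act ((E p).inner x (T.1 y)) = 0) :
    ‖(E (p * r)).act a‖ ≤ ‖(E p).left.toAdjointable a - T‖ := by
  refine ContinuousLinearMap.opNorm_le_bound _ (norm_nonneg _) fun z => ?_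
  obtain ⟨t, rfl⟩ := (𝓔.mul p r).toLinearEquiv.surjective z
  rw [← (𝓔.mul p r).map_act, (𝓔.mul p r).norm_map, (𝓔.mul p r).norm_map,
    ← amplification_act_toAdjointable]
  have h : ((E p).toHilbertModule.amplification (E r)).act ((E p).left.toAdjointable a)
      = ((E p).toHilbertModule.amplification (E r)).act ((E p).left.toAdjointable a - T) := by
    rw [map_sub, amplification_act_eq_zero hT, sub_zero]
  rw [h]
  exact ((E p).toHilbertModule.amplification (E r)).left.norm_act_le _ t

/-- Compactness of `φ_p a` is essential: it turns the pointwise statement that `φ_p(a) x` lies in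
the closed span of `E_p · I` into norm approximation of `φ_p a` by operators in `locallyZero`. -/
theorem quotientLeft_injective {p : P} (h : (E p).IsProper) :
    Function.Injective (𝓔.quotientLeft hP p).act := by
  refine (injective_iff_map_eq_zero _).2 fun a ha => ?_
  obtain ⟨a, rfl⟩ := (𝓔.kernelIdeal hP).proj_surjective a
  rw [(𝓔.kernelIdeal hP).proj_eq_zero_iff]
  let T := (E p).left.toAdjointable a
  have hT : T ∈ (𝓔.locallyZero hP p).topologicalClosure := by
    refine Adjointable.mem_of_forall_rankOne_mem (h a) _
      (Submodule.isClosed_topologicalClosure _) fun x y => ?_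
    refine 𝓔.rankOne_mem_closure_locallyZero hP ?_ y
    rw [← map_eq_zero_iff (𝓔.inner_fibreMap hP p)]
    exact (𝓔.quotientLeft_act_fibreMap hP p a x).symm.trans (by rw [ha, zero_apply])
  refine Metric.mem_closure_iff.2 fun ε hε => ?_
  obtain ⟨F, ⟨r, hF⟩, hn⟩ := Metric.mem_closure_iff.1 hT (ε / 2) (half_pos hε)
  rw [dist_eq_norm] at hn
  -- One half of `ε` bounds `‖φ_(pr) a‖` through `F`; the other half is the error in realising this
  -- norm as a distance to `ker φ_(pr)`.
  obtain ⟨b, hb, hb'⟩ := NonUnitalStarAlgHom.exists_norm_sub_lt (E (p * r)).left.toAdjointable a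
    (half_pos hε)
  refine ⟨b, Set.mem_iUnion.2 ⟨p * r, congrArg Subtype.val hb⟩, ?_⟩
  have h1 : ‖(E (p * r)).left.toAdjointable a‖ ≤ ‖T - F‖ := 𝓔.norm_act_mul_le a hF
  rw [dist_eq_norm]
  linarith

end ProductSystem

/-! ### Nondegenerate representations -/

namespace ProductSystem

open HilbertModule

variable {P A : Type*} [Monoid P] [NonUnitalCStarAlgebra A] {E : P → Correspondence A A}
  {𝓔 : ProductSystem E}

namespace NondegenerateRepresentation

variable {B : Type*} [NonUnitalCStarAlgebra B] {F : HilbertModule B}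

theorem ext {R R' : 𝓔.NondegenerateRepresentation F} (h : ∀ a, R.left.act a = R'.left.act a)
    (h' : ∀ p x, R.S p x = R'.S p x) : R = R' := by
  obtain ⟨l, S, _⟩ := R
  obtain ⟨l', S', _⟩ := R'
  obtain rfl : l = l' := LeftAction.ext h
  obtain rfl : S = S' := funext fun p => LinearMap.ext (h' p)
  rfl

variable (hP : IsRightOre P)

/-- A representation of the quotient product system is a representation of the product system. -/
noncomputable def ofQuotient (R : (𝓔.quotient hP).NondegenerateRepresentation F) :
    𝓔.NondegenerateRepresentation F where
  left := R.left.comp (𝓔.quotientMap hP) (𝓔.kernelIdeal hP).proj_surjective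
  S p := (R.S p).comp (𝓔.fibreMap hP p).toLinearMap
  adjointable p x := R.adjointable p _
  S_unit a := by
    refine Eq.trans ?_ (R.S_unit (𝓔.quotientMap hP a))
    exact congrArg (R.S 1) (𝓔.quotient_unit hP a).symm
  S_act p a x := by
    refine Eq.trans ?_ (R.S_act p (𝓔.quotientMap hP a) (𝓔.fibreMap hP p x))
    exact congrArg (R.S p) (𝓔.quotientLeft_act_fibreMap hP p a x).symm
  inner_S p x y v w := by
    refine (R.inner_S p (𝓔.fibreMap hP p x) (𝓔.fibreMap hP p y) v w).trans ?_
    exact congrArg (fun a => F.inner v (R.left.act a w)) (𝓔.inner_fibreMap hP p x y)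
  S_mul p r x y := by
    refine (R.S_mul p r (𝓔.fibreMap hP p x) (𝓔.fibreMap hP r y)).trans ?_
    exact congrArg (R.S (p * r)) (𝓔.quotient_mul hP p r x y)
  nondegenerate p := (R.nondegenerate p).mono <| Submodule.span_mono <| by
    rintro _ ⟨x, v, rfl⟩
    obtain ⟨x, rfl⟩ := 𝓔.fibreMap_surjective hP p x
    exact ⟨x, v, rfl⟩

/-- If `φ_r a = 0`, then `a S_r(x) v = S_r(a x) v = 0`, and these vectors `S_r(x) v` span a dense
subspace by nondegeneracy at `r`. -/
theorem act_eq_zero (R : 𝓔.NondegenerateRepresentation F) {a : A}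
    (ha : a ∈ (𝓔.kernelIdeal hP).toSubmodule) : R.left.act a = 0 := by
  refine closure_minimal (t := {a | R.left.act a = 0}) ?_
    (isClosed_eq R.left.continuous_act continuous_const) ha
  intro a ha
  obtain ⟨r, hr⟩ := Set.mem_iUnion.1 ha
  refine ContinuousLinearMap.ext_on (R.nondegenerate r) ?_
  rintro _ ⟨x, v, rfl⟩
  have h := R.S_act r a x
  rw [show (E r).act a = 0 from hr, zero_apply, map_zero] at h
  exact (DFunLike.congr_fun h v).symm

/-- If `q_p x = 0`, then `⟨x, x⟩ ∈ I` acts by zero, so `‖S_p(x) v‖² = ‖⟨v, ⟨x, x⟩ v⟩‖ = 0`. -/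
theorem S_eq_zero (R : 𝓔.NondegenerateRepresentation F) {p : P} {x : E p}
    (hx : 𝓔.fibreMap hP p x = 0) : R.S p x = 0 := by
  ext v
  refine F.eq_zero_of_inner_self_eq_zero ?_
  rw [R.inner_S, R.act_eq_zero hP ((𝓔.fibreMap_eq_zero_iff_inner hP p x).1 hx), zero_apply,
    map_zero]

/-- The map on the quotient fibre induced by a representation. -/
noncomputable def quotientS (R : 𝓔.NondegenerateRepresentation F) (p : P) :
    𝓔.quotientFibre hP p →ₗ[ℂ] (F →L[ℂ] F) :=
  𝓔.fibreLift hP p (R.S p) fun _ => R.S_eq_zero hP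

theorem quotientS_fibreMap (R : 𝓔.NondegenerateRepresentation F) (p : P) (x : E p) :
    R.quotientS hP p (𝓔.fibreMap hP p x) = R.S p x :=
  𝓔.fibreLift_fibreMap hP p _ _ x

/-- The representation of the quotient product system induced by a representation. -/
noncomputable def toQuotient (R : 𝓔.NondegenerateRepresentation F) :
    (𝓔.quotient hP).NondegenerateRepresentation F where
  left := R.left.descend (𝓔.kernelIdeal hP) fun _ => R.act_eq_zero hP
  S := R.quotientS hP
  adjointable p x := by
    obtain ⟨x, rfl⟩ := 𝓔.fibreMap_surjective hP p x
    rw [quotientS_fibreMap]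
    exact R.adjointable p x
  S_unit a := by
    obtain ⟨a, rfl⟩ := (𝓔.kernelIdeal hP).proj_surjective a
    rw [quotient_unit, quotientS_fibreMap]
    exact R.S_unit a
  S_act p a x := by
    obtain ⟨a, rfl⟩ := (𝓔.kernelIdeal hP).proj_surjective a
    obtain ⟨x, rfl⟩ := 𝓔.fibreMap_surjective hP p x
    rw [quotientLeft_act_fibreMap, quotientS_fibreMap, quotientS_fibreMap]
    exact R.S_act p a x
  inner_S p x y v w := by
    obtain ⟨x, rfl⟩ := 𝓔.fibreMap_surjective hP p x
    obtain ⟨y, rfl⟩ := 𝓔.fibreMap_surjective hP p y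
    rw [quotientS_fibreMap, quotientS_fibreMap, R.inner_S]
    exact congrArg (fun a => F.inner v
      ((R.left.descend (𝓔.kernelIdeal hP) fun _ => R.act_eq_zero hP).act a w))
      (𝓔.inner_fibreMap hP p x y).symm
  S_mul p r x y := by
    obtain ⟨x, rfl⟩ := 𝓔.fibreMap_surjective hP p x
    obtain ⟨y, rfl⟩ := 𝓔.fibreMap_surjective hP r y
    rw [quotient_mul, quotientS_fibreMap, quotientS_fibreMap, quotientS_fibreMap]
    exact R.S_mul p r x y
  nondegenerate p := (R.nondegenerate p).mono <| Submodule.span_mono <| by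
    rintro _ ⟨x, v, rfl⟩
    exact ⟨𝓔.fibreMap hP p x, v, by rw [quotientS_fibreMap]⟩

/-- The product system and its quotient have the same nondegenerate representations. -/
noncomputable def quotientEquiv :
    (𝓔.quotient hP).NondegenerateRepresentation F ≃ 𝓔.NondegenerateRepresentation F where
  toFun := ofQuotient hP
  invFun := toQuotient hP
  left_inv R := by
    refine ext (fun a => ?_) fun p x => ?_
    · obtain ⟨a, rfl⟩ := (𝓔.kernelIdeal hP).proj_surjective a
      rfl
    · obtain ⟨x, rfl⟩ := 𝓔.fibreMap_surjective hP p x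
      exact quotientS_fibreMap hP _ p x
  right_inv R := ext (fun a => rfl) fun p x => quotientS_fibreMap hP R p x

end NondegenerateRepresentation

end ProductSystem

/-! ### The map on compact operators induced by a map into a C⋆-algebra -/

namespace HilbertModule

variable {A B : Type*} [NonUnitalCStarAlgebra A] [NonUnitalCStarAlgebra B] {X : HilbertModule A}
  {π : A →⋆ₙₐ[ℂ] B} {S : X →ₗ[ℂ] B}

/-- The map `x ⊗ b ↦ S x * b`. -/
noncomputable def mulTensor (S : X →ₗ[ℂ] B) : X ⊗[ℂ] B →ₗ[ℂ] B :=
  TensorProduct.lift ((LinearMap.mul ℂ B).comp S)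

theorem mulTensor_tmul (x : X) (b : B) :
    mulTensor S (x ⊗ₜ b) = S x * b := rfl

/-- The algebraic tensor product `X ⊗ B` with the inner product pulled back along
`x ⊗ b ↦ S x * b`. -/
noncomputable def pullbackTensor (S : X →ₗ[ℂ] B) : PreHilbertModule B where
  carrier := X ⊗[ℂ] B
  rsmul := (LinearMap.lTensorHom X).comp (LinearMap.mul ℂ B).flip |>.flip
  inner := LinearMap.mk₂'ₛₗ (starRingEnd ℂ) (RingHom.id ℂ)
    (fun s t => star (mulTensor S s) * mulTensor S t)
    (fun x y z => by rw [map_add, star_add, add_mul])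
    (fun c x y => by rw [map_smul, star_smul, smul_mul_assoc]; rfl)
    (fun x y z => by rw [map_add, mul_add])
    (fun c x y => by rw [map_smul, mul_smul_comm]; rfl)
  rsmul_rsmul t a b := by
    induction t using TensorProduct.induction_on with
    | zero => simp
    | tmul x y => simp [mul_assoc]
    | add s t hs ht => simp only [map_add, LinearMap.add_apply, hs, ht]
  inner_rsmul s t b := by
    change star (mulTensor S s) * mulTensor S ((LinearMap.mulRight ℂ b).lTensor X t)
      = star (mulTensor S s) * mulTensor S t * b
    induction t using TensorProduct.induction_on with
    | zero => simp
    | tmul x y =>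
      change _ * (S x * (y * b)) = _ * (S x * y) * b
      simp only [mul_assoc]
    | add s t hs ht => simp only [map_add, mul_add, add_mul, hs, ht]
  star_inner s t := by simp
  inner_self t := ⟨_, rfl⟩

/-- The operators `T ⊗ 1` on `X ⊗ B`. -/
noncomputable def pullbackTensorAct (S : X →ₗ[ℂ] B) :
    X.adjointable →ₙₐ[ℂ] Module.End ℂ (pullbackTensor S) where
  toFun T := T.1.toLinearMap.rTensor B
  map_smul' z T := TensorProduct.ext' fun x y => by
    change (z • T.1 x) ⊗ₜ[ℂ] y = z • (T.1 x ⊗ₜ[ℂ] y)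
    rw [TensorProduct.smul_tmul']
  map_zero' := TensorProduct.ext' fun x y => TensorProduct.zero_tmul _ _
  map_add' T T' := TensorProduct.ext' fun x y => TensorProduct.add_tmul _ _ _
  map_mul' T T' := TensorProduct.ext' fun x y => rfl

/-- The pulled-back norm of `t` is `‖mulTensor S t‖`, and the operators `T ⊗ 1` form a
star-representation for it, since `S(T y)* S(x) = π ⟨T y, x⟩ = S(y)* S(T* x)`. Such representations
are contractive. -/
theorem norm_mulTensor_le (hS : ∀ x y, star (S x) * S y = π (X.inner x y))
    (T : X.adjointable) (t : X ⊗[ℂ] B) :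
    ‖mulTensor S (T.1.toLinearMap.rTensor B t)‖ ≤ ‖T‖ * ‖mulTensor S t‖ := by
  have hn : ∀ t : pullbackTensor S, ‖t‖ = ‖mulTensor S t‖ := fun t => by
    rw [PreHilbertModule.norm_def]
    change √‖star (mulTensor S t) * mulTensor S t‖ = _
    rw [CStarRing.norm_star_mul_self, Real.sqrt_mul_self (norm_nonneg _)]
  have h := (pullbackTensor S).norm_act_le (pullbackTensorAct S) (fun T s t => ?_) T t
  · exact (hn _).symm.trans_le (h.trans_eq (congrArg (‖T‖ * ·) (hn t)))
  change X ⊗[ℂ] B at s t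
  change star (mulTensor S (T.1.toLinearMap.rTensor B s)) * mulTensor S t
    = star (mulTensor S s) * mulTensor S ((star T).1.toLinearMap.rTensor B t)
  induction t using TensorProduct.induction_on with
  | zero => simp
  | tmul x b =>
    induction s using TensorProduct.induction_on with
    | zero => simp
    | tmul y c =>
      have h1 := hS (T.1 y) x
      have h2 := hS y ((star T).1 x)
      rw [Adjointable.inner_left, ← h2] at h1
      change star (S (T.1 y) * c) * (S x * b) = star (S y * c) * (S ((star T).1 x) * b)
      rw [star_mul, star_mul, mul_assoc, mul_assoc, ← mul_assoc (star _) _ b, h1, mul_assoc]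
    | add s t hs ht => simp only [map_add, star_add, add_mul, hs, ht]
  | add s t hs ht => simp only [map_add, mul_add, hs, ht]

/-- A map `S` from `X` to a C⋆-algebra that respects inner products induces a bounded linear map
on the compact operators, with `|x⟩⟨y| ↦ S x * star (S y)`. -/
theorem exists_compactOperators_hom_of_inner {S : X →ₗ[ℂ] B}
    (hS : ∀ x y, star (S x) * S y = π (X.inner x y)) :
    ∃ ϑ : X.compactOperators →L[ℂ] B, ∀ x y, ϑ (X.compactRankOne x y) = S x * star (S y) := by
  -- Regarding `B` as a Hilbert module over itself gives `S (x · a) = S x * π a` from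
  -- `map_rsmul_of_inner`.
  let U : X →L[ℂ] self B := LinearMap.mkContinuous (F := self B) S 1 fun x => by
    rw [one_mul]
    refine le_of_sq_le_sq ?_ (norm_nonneg _)
    rw [X.norm_sq, HilbertModule.norm_sq]
    exact (congrArg norm (hS x x)).trans_le (NonUnitalStarAlgHom.norm_apply_le π _)
  have hU : ∀ x y, (self B).inner (U x) (U y) = π (X.inner x y) := hS
  refine X.exists_compactOperators_hom (fun p => S p.1 * star (S p.2)) fun c => ?_
  set w := Finsupp.linearCombination ℂ (fun p : X × X => S p.1 * star (S p.2)) c with hw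
  set T : X.adjointable :=
    Finsupp.linearCombination ℂ (fun p : X × X => Adjointable.rankOne X p.1 p.2) c with hT
  have hT' : T.1 = Finsupp.linearCombination ℂ (fun p : X × X => X.rankOne p.1 p.2) c := by
    rw [hT, Finsupp.linearCombination_apply, Finsupp.linearCombination_apply, Finsupp.sum,
      Finsupp.sum, AddSubmonoidClass.coe_finsetSum]
    rfl
  -- `S` intertwines `T` with left multiplication by `w`, because `S (x ⟨y, z⟩) = S(x) S(y)* S(z)`.
  have hST : ∀ z, S (T.1 z) = w * S z := fun z => by
    have h : ∀ x y, S (X.rankOne x y z) = S x * (star (S y) * S z) := fun x y => by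
      rw [hS]; exact map_rsmul_of_inner hU x (X.inner y z)
    rw [hT', hw]
    simp only [Finsupp.linearCombination_apply, Finsupp.sum, _root_.sum_apply, map_sum,
      smul_apply, map_smul, h, Finset.sum_mul, smul_mul_assoc, mul_assoc]
  have hm : ∀ t : X ⊗[ℂ] B, mulTensor S (T.1.toLinearMap.rTensor B t) = w * mulTensor S t :=
    fun t => by
      induction t using TensorProduct.induction_on with
      | zero => simp
      | tmul x b => exact (congrArg (· * b) (hST x)).trans (mul_assoc _ _ _)
      | add s t hs ht => simp only [map_add, mul_add, hs, ht]
  -- The element `w*` is a combination of products `S(y) S(x)*`, so it is in the range of `mulTensor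
  -- S`. Then `w w*` is the image of `(T ⊗ 1) t`, and `‖w‖² ≤ ‖T‖ ‖w‖`.
  obtain ⟨t, ht⟩ : ∃ t, mulTensor S t = star w := by
    rw [hw]
    clear_value w T
    clear hST hm hT hT' hw
    induction c using Finsupp.induction_linear with
    | zero => exact ⟨0, by simp⟩
    | add f g hf hg =>
      obtain ⟨s, hs⟩ := hf
      obtain ⟨t, ht⟩ := hg
      exact ⟨s + t, by rw [map_add, map_add, star_add, hs, ht]⟩
    | single p c =>
      refine ⟨p.2 ⊗ₜ (star c • star (S p.1)), ?_⟩
      rw [mulTensor_tmul, Finsupp.linearCombination_single, star_smul, star_mul, star_star,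
        mul_smul_comm]
  rw [← hT']
  change ‖w‖ ≤ ‖T‖
  have h := norm_mulTensor_le hS T t
  rw [hm, ht, CStarRing.norm_self_mul_star, norm_star] at h
  rcases eq_or_ne ‖w‖ 0 with h0 | h0
  · rw [h0]; exact norm_nonneg _
  · exact le_of_mul_le_mul_right h (lt_of_le_of_ne (norm_nonneg _) h0.symm)

end HilbertModule

/-! ### Isomorphisms between generated C⋆-algebras -/

/-- Restriction of bounded families along a map of index types. -/
def lpInftyReindex {ι ι' : Type*} {B : ι → Type*} [∀ i, NonUnitalCStarAlgebra (B i)] (d : ι' → ι) :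
    lp B ∞ →⋆ₙₐ[ℂ] lp (fun i => B (d i)) ∞ where
  toFun t := ⟨fun i => t (d i), memℓp_infty ⟨‖t‖, by
    rintro _ ⟨i, rfl⟩
    exact lp.norm_apply_le_norm ENNReal.top_ne_zero t (d i)⟩⟩
  map_smul' _ _ := rfl
  map_zero' := rfl
  map_add' _ _ := rfl
  map_mul' _ _ := rfl
  map_star' _ := rfl

namespace NonUnitalStarAlgebra

variable {L M : Type*} [NonUnitalCStarAlgebra L] [NonUnitalCStarAlgebra M]

theorem map_mem_closure_adjoin (f : L →⋆ₙₐ[ℂ] M) {S : Set L} {T : Set M} (h : ∀ s ∈ S, f s ∈ T)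
    {x : L} (hx : x ∈ (adjoin ℂ S).topologicalClosure) :
    f x ∈ (adjoin ℂ T).topologicalClosure := by
  refine NonUnitalStarSubalgebra.topologicalClosure_minimal
    (t := ((adjoin ℂ T).topologicalClosure).comap f) _ (adjoin_le fun s hs => ?_)
    ((NonUnitalStarSubalgebra.isClosed_topologicalClosure _).preimage f.continuous_of_cstar) hx
  exact NonUnitalStarSubalgebra.le_topologicalClosure _ (subset_adjoin ℂ _ (h s hs))

theorem eq_of_mem_closure_adjoin {f g : L →⋆ₙₐ[ℂ] M} {S : Set L} (h : ∀ s ∈ S, f s = g s)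
    {x : L} (hx : x ∈ (adjoin ℂ S).topologicalClosure) : f x = g x :=
  NonUnitalStarSubalgebra.topologicalClosure_minimal
    (t := NonUnitalStarAlgHom.equalizer f g) _ (adjoin_le h)
    (isClosed_eq f.continuous_of_cstar g.continuous_of_cstar) hx

/-- Two homomorphisms that are inverse to each other on generating sets restrict to an isomorphism
of the generated C⋆-algebras. -/
theorem exists_starAlgEquiv_closure_adjoin (f : L →⋆ₙₐ[ℂ] M) (g : M →⋆ₙₐ[ℂ] L)
    (S : Set L) (T : Set M) (hf : ∀ s ∈ S, f s ∈ T ∧ g (f s) = s)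
    (hg : ∀ t ∈ T, g t ∈ S ∧ f (g t) = t) :
    ∃ Φ : (adjoin ℂ S).topologicalClosure ≃⋆ₐ[ℂ] (adjoin ℂ T).topologicalClosure,
      ∀ x, (Φ x : M) = f x :=
  ⟨{ toFun := fun x => ⟨f x, map_mem_closure_adjoin f (fun s hs => (hf s hs).1) x.2⟩
     invFun := fun x => ⟨g x, map_mem_closure_adjoin g (fun t ht => (hg t ht).1) x.2⟩
     left_inv := fun x => Subtype.ext <| eq_of_mem_closure_adjoin (f := g.comp f)
       (g := NonUnitalStarAlgHom.id ℂ L) (fun s hs => (hf s hs).2) x.2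
     right_inv := fun x => Subtype.ext <| eq_of_mem_closure_adjoin (f := f.comp g)
       (g := NonUnitalStarAlgHom.id ℂ M) (fun t ht => (hg t ht).2) x.2
     map_mul' := fun x y => Subtype.ext (map_mul f x.1 y.1)
     map_add' := fun x y => Subtype.ext (map_add f x.1 y.1)
     map_star' := fun x => Subtype.ext (map_star f x.1)
     map_smul' := fun c x => Subtype.ext (map_smul f c x.1) }, fun _ => rfl⟩

end NonUnitalStarAlgebra

/-! ### Cuntz-Pimsner covariant representations -/

namespace ProductSystem

open HilbertModule

variable {P A : Type*} [Monoid P] [NonUnitalCStarAlgebra A] {E : P → Correspondence A A}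
  {𝓔 : ProductSystem E}

/-- On a proper product system, the map `κ` from `𝕂(E_p)` to `𝕂(E'_p)` maps the left action of
`A` to that of `A'`. -/
theorem exists_compactOperators_quotient (𝓔 : ProductSystem E) (hP : IsRightOre P)
    (hproper : ∀ p, (E p).IsProper) (p : P) :
    ∃ κ : (E p).toHilbertModule.compactOperators →L[ℂ] (𝓔.quotientFibre hP p).compactOperators,
      (∀ x y, κ ((E p).toHilbertModule.compactRankOne x y)
        = (𝓔.quotientFibre hP p).compactRankOne (𝓔.fibreMap hP p x) (𝓔.fibreMap hP p y)) ∧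
      ∀ a, κ ⟨(E p).act a, hproper p a⟩
        = ⟨(𝓔.quotientLeft hP p).act (𝓔.quotientMap hP a),
          𝓔.quotient_isProper hP (hproper p) (𝓔.quotientMap hP a)⟩ := by
  obtain ⟨κ, hκ, hκ'⟩ := exists_compactOperators_map (𝓔.inner_fibreMap hP p)
    (𝓔.fibreMap_surjective hP p)
  refine ⟨κ, hκ, fun a => Subtype.ext (ContinuousLinearMap.ext fun y => ?_)⟩
  obtain ⟨x, rfl⟩ := 𝓔.fibreMap_surjective hP p y
  rw [hκ']
  exact (𝓔.quotientLeft_act_fibreMap hP p a x).symm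

namespace CovariantRepresentation

variable {B : Type*} [NonUnitalCStarAlgebra B] (hP : IsRightOre P)

/-- A covariant representation of the quotient product system is one of the product system. -/
noncomputable def ofQuotient (hproper : ∀ p, (E p).IsProper)
    (R : (𝓔.quotient hP).CovariantRepresentation B) :
    𝓔.CovariantRepresentation B where
  hom := R.hom.comp (𝓔.quotientMap hP)
  S p := (R.S p).comp (𝓔.fibreMap hP p).toLinearMap
  S_unit a := by
    refine Eq.trans ?_ (R.S_unit (𝓔.quotientMap hP a))
    exact congrArg (R.S 1) (𝓔.quotient_unit hP a).symm
  S_act p a x := by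
    refine Eq.trans ?_ (R.S_act p (𝓔.quotientMap hP a) (𝓔.fibreMap hP p x))
    exact congrArg (R.S p) (𝓔.quotientLeft_act_fibreMap hP p a x).symm
  inner_S p x y := by
    refine (R.inner_S p (𝓔.fibreMap hP p x) (𝓔.fibreMap hP p y)).trans ?_
    exact congrArg R.hom (𝓔.inner_fibreMap hP p x y)
  S_mul p r x y := by
    refine (R.S_mul p r (𝓔.fibreMap hP p x) (𝓔.fibreMap hP r y)).trans ?_
    exact congrArg (R.S (p * r)) (𝓔.quotient_mul hP p r x y)
  covariant p := by
    obtain ⟨ϑ, hϑ, hϑ'⟩ := R.covariant p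
    obtain ⟨κ, hκ, hκ'⟩ := 𝓔.exists_compactOperators_quotient hP hproper p
    refine ⟨ϑ.comp κ, fun x y => ?_, fun a ha => ?_⟩
    · exact (congrArg ϑ (hκ x y)).trans (hϑ _ _)
    · exact (congrArg ϑ (hκ' a)).trans (hϑ' _ _)

/-- Covariance plays the role of nondegeneracy: if `φ_r a = 0`, then properness allows covariance to
be applied, and `hom a = ϑ (φ_r a) = 0`. -/
theorem hom_eq_zero (hproper : ∀ p, (E p).IsProper)
    (R : 𝓔.CovariantRepresentation B) {a : A}
    (ha : a ∈ (𝓔.kernelIdeal hP).toSubmodule) : R.hom a = 0 := by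
  refine closure_minimal (t := {a | R.hom a = 0}) ?_
    (isClosed_eq R.hom.continuous_of_cstar continuous_const) ha
  intro a ha
  obtain ⟨r, hr⟩ := Set.mem_iUnion.1 ha
  obtain ⟨ϑ, -, hϑ⟩ := R.covariant r
  refine (hϑ a (hproper r a)).symm.trans ?_
  rw [← map_zero ϑ]
  exact congrArg ϑ (Subtype.ext hr)

theorem S_eq_zero (hproper : ∀ p, (E p).IsProper)
    (R : 𝓔.CovariantRepresentation B) {p : P} {x : E p}
    (hx : 𝓔.fibreMap hP p x = 0) : R.S p x = 0 := by
  rw [← CStarRing.star_mul_self_eq_zero_iff, R.inner_S,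
    R.hom_eq_zero hP hproper ((𝓔.fibreMap_eq_zero_iff_inner hP p x).1 hx)]

/-- The map on the quotient fibre induced by a covariant representation. -/
noncomputable def quotientS (hproper : ∀ p, (E p).IsProper)
    (R : 𝓔.CovariantRepresentation B) (p : P) :
    𝓔.quotientFibre hP p →ₗ[ℂ] B :=
  𝓔.fibreLift hP p (R.S p) fun _ => R.S_eq_zero hP hproper

theorem quotientS_fibreMap (hproper : ∀ p, (E p).IsProper)
    (R : 𝓔.CovariantRepresentation B) (p : P) (x : E p) :
    R.quotientS hP hproper p (𝓔.fibreMap hP p x) = R.S p x :=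
  𝓔.fibreLift_fibreMap hP p _ _ x

/-- The covariant representation of the quotient product system induced by a covariant
representation. -/
noncomputable def toQuotient (hproper : ∀ p, (E p).IsProper)
    (R : 𝓔.CovariantRepresentation B) :
    (𝓔.quotient hP).CovariantRepresentation B where
  hom := (𝓔.kernelIdeal hP).liftStar R.hom fun _ => R.hom_eq_zero hP hproper
  S := R.quotientS hP hproper
  S_unit a := by
    obtain ⟨a, rfl⟩ := (𝓔.kernelIdeal hP).proj_surjective a
    rw [quotient_unit, quotientS_fibreMap]
    exact R.S_unit a
  S_act p a x := by
    obtain ⟨a, rfl⟩ := (𝓔.kernelIdeal hP).proj_surjective a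
    obtain ⟨x, rfl⟩ := 𝓔.fibreMap_surjective hP p x
    rw [quotientLeft_act_fibreMap, quotientS_fibreMap, quotientS_fibreMap]
    exact R.S_act p a x
  inner_S p x y := by
    obtain ⟨x, rfl⟩ := 𝓔.fibreMap_surjective hP p x
    obtain ⟨y, rfl⟩ := 𝓔.fibreMap_surjective hP p y
    rw [quotientS_fibreMap, quotientS_fibreMap, R.inner_S]
    exact congrArg ((𝓔.kernelIdeal hP).liftStar R.hom fun _ => R.hom_eq_zero hP hproper)
      (𝓔.inner_fibreMap hP p x y).symm
  S_mul p r x y := by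
    obtain ⟨x, rfl⟩ := 𝓔.fibreMap_surjective hP p x
    obtain ⟨y, rfl⟩ := 𝓔.fibreMap_surjective hP r y
    rw [quotient_mul, quotientS_fibreMap, quotientS_fibreMap, quotientS_fibreMap]
    exact R.S_mul p r x y
  covariant p := by
    obtain ⟨ϑ, hϑ, hϑ'⟩ := R.covariant p
    obtain ⟨κ, hκ, hκ'⟩ := 𝓔.exists_compactOperators_quotient hP hproper p
    -- The map `ψ` is built on `𝕂(E'_p)` directly, not by descending `ϑ` along `κ`. The identity `ψ
    -- ∘ κ = ϑ` holds on rank-one operators, and covariance follows: `ψ (φ'_p (π a)) = ψ (κ (φ_p a))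
    -- = ϑ (φ_p a) = hom a`.
    obtain ⟨ψ, hψ⟩ := exists_compactOperators_hom_of_inner (X := 𝓔.quotientFibre hP p)
      (S := R.quotientS hP hproper p)
      (π := (𝓔.kernelIdeal hP).liftStar R.hom fun _ => R.hom_eq_zero hP hproper) fun x y => by
        obtain ⟨x, rfl⟩ := 𝓔.fibreMap_surjective hP p x
        obtain ⟨y, rfl⟩ := 𝓔.fibreMap_surjective hP p y
        rw [quotientS_fibreMap, quotientS_fibreMap, R.inner_S, inner_fibreMap]
        rfl
    refine ⟨ψ, hψ, fun a ha => ?_⟩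
    obtain ⟨a, rfl⟩ := (𝓔.kernelIdeal hP).proj_surjective a
    have h : ψ.comp κ = ϑ := compactOperators_hom_ext fun x y => by
      refine (congrArg ψ (hκ x y)).trans ((hψ _ _).trans ?_)
      rw [quotientS_fibreMap, quotientS_fibreMap]
      exact (hϑ x y).symm
    refine (congrArg ψ (hκ' a)).symm.trans ?_
    exact (DFunLike.congr_fun h _).trans (hϑ' a _)

end CovariantRepresentation

end ProductSystem

/-! ### The isomorphism of the Cuntz-Pimsner algebras -/

namespace ProductSystem
universe u v w

variable {P : Type w} {A : Type u} [Monoid P] [NonUnitalCStarAlgebra A]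
  {E : P → Correspondence.{v} A A} (𝓔 : ProductSystem E)

/-- Passing between the representations of the two systems keeps the target algebra, hence its
universe, so it reindexes the `ℓ^∞`-products. The two reindexings need to be mutually inverse only
on the canonical generators, where this is the factorisation `S_p = S'_p ∘ q_p`. -/
theorem exists_cuntzPimsner_equiv (hP : IsRightOre P) (hproper : ∀ p, (E p).IsProper) :
    ∃ Φ : 𝓔.CuntzPimsner ≃⋆ₐ[ℂ] (𝓔.quotient hP).CuntzPimsner,
      ∀ p x, Φ (𝓔.toCuntzPimsner p x)
        = (𝓔.quotient hP).toCuntzPimsner p (𝓔.fibreMap hP p x) := by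
  let d : (𝓔.quotient hP).CovariantIndex → 𝓔.CovariantIndex := fun ρ =>
    ⟨ρ.B, ρ.rep.ofQuotient hP hproper⟩
  let d' : 𝓔.CovariantIndex → (𝓔.quotient hP).CovariantIndex := fun ρ =>
    ⟨ρ.B, ρ.rep.toQuotient hP hproper⟩
  let f : lp (fun ρ : 𝓔.CovariantIndex => ρ.B) ∞ →⋆ₙₐ[ℂ]
    lp (fun ρ : (𝓔.quotient hP).CovariantIndex => ρ.B) ∞ := lpInftyReindex d
  let g : lp (fun ρ : (𝓔.quotient hP).CovariantIndex => ρ.B) ∞ →⋆ₙₐ[ℂ]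
    lp (fun ρ : 𝓔.CovariantIndex => ρ.B) ∞ := lpInftyReindex d'
  have hf : ∀ p x, f (𝓔.cuntzPimsnerAux p x)
      = (𝓔.quotient hP).cuntzPimsnerAux p (𝓔.fibreMap hP p x) := fun p x => rfl
  have hg : ∀ p x, g ((𝓔.quotient hP).cuntzPimsnerAux p (𝓔.fibreMap hP p x))
      = 𝓔.cuntzPimsnerAux p x := fun p x => by
    ext ρ
    exact ρ.rep.quotientS_fibreMap hP hproper p x
  obtain ⟨Φ, hΦ⟩ := NonUnitalStarAlgebra.exists_starAlgEquiv_closure_adjoin f g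
    {t | ∃ p x, t = 𝓔.cuntzPimsnerAux p x} {t | ∃ p x, t = (𝓔.quotient hP).cuntzPimsnerAux p x}
    (by
      rintro _ ⟨p, x, rfl⟩
      exact ⟨⟨p, _, hf p x⟩, by rw [hf, hg]⟩)
    (by
      rintro _ ⟨p, y, rfl⟩
      obtain ⟨x, rfl⟩ := 𝓔.fibreMap_surjective hP p y
      exact ⟨⟨p, _, hg p x⟩, by rw [hg, hf]⟩)
  exact ⟨Φ, fun p x => Subtype.ext (hΦ _)⟩

end ProductSystem

theorem mainTheorem4 {P : Type*} [Monoid P] (hP : IsRightOre P)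
    {A : Type*} [NonUnitalCStarAlgebra A] {E : P → Correspondence A A}
    (𝓔 : ProductSystem E) (hproper : ∀ p, (E p).IsProper) :
    ∃ (L : ∀ p, LeftAction (𝓔.QuotientAlgebra hP) (𝓔.quotientFibre hP p))
      (𝓔' : ProductSystem (𝓔.quotientFibres hP L))
      (q : ∀ p, E p →L[ℂ] 𝓔.quotientFibre hP p),
      (∀ p a, (L p).act (𝓔.quotientMap hP a)
        = ((E p).tensor (𝓔.quotientCorrespondence hP)).act a) ∧
      (∀ p x a, q p ((E p).rsmul x a) = 𝓔.quotientTmul hP p x (𝓔.quotientMap hP a)) ∧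
      (∀ p, Function.Surjective (q p)) ∧
      (∀ p x, q p x = 0 ↔ x ∈ (Submodule.span ℂ
        {y | ∃ z, ∃ a ∈ (𝓔.kernelIdeal hP).toSubmodule, y = (E p).rsmul z a}).topologicalClosure) ∧
      (∀ a, 𝓔'.unit (𝓔.quotientMap hP a) = q 1 (𝓔.unit a)) ∧
      (∀ p r x y,
        𝓔'.mul p r ((𝓔.quotientFibres hP L p).tmul (𝓔.quotientFibres hP L r) (q p x) (q r y))
          = q (p * r) (𝓔.mul p r ((E p).tmul (E r) x y))) ∧
      (∀ p, (𝓔.quotientFibres hP L p).IsProper) ∧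
      (∀ p, Function.Injective (L p).act) ∧
      (∀ (B : Type*) [NonUnitalCStarAlgebra B] (F : HilbertModule B),
        ∃ e : 𝓔'.NondegenerateRepresentation F ≃ 𝓔.NondegenerateRepresentation F,
          ∀ R p x, (e R).S p x = R.S p (q p x)) ∧
      ∃ Φ : 𝓔.CuntzPimsner ≃⋆ₐ[ℂ] 𝓔'.CuntzPimsner,
        ∀ p x, Φ (𝓔.toCuntzPimsner p x) = 𝓔'.toCuntzPimsner p (q p x) := by
  refine ⟨𝓔.quotientLeft hP, 𝓔.quotient hP, 𝓔.fibreMap hP, fun p a => rfl, 𝓔.fibreMap_rsmul hP,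
    𝓔.fibreMap_surjective hP,
    fun p => HilbertModule.map_eq_zero_iff (𝓔.inner_fibreMap hP p), 𝓔.quotient_unit hP,
    𝓔.quotient_mul hP, fun p => 𝓔.quotient_isProper hP (hproper p),
    fun p => 𝓔.quotientLeft_injective hP (hproper p),
    fun B _ F => ⟨ProductSystem.NondegenerateRepresentation.quotientEquiv hP, fun R p x => rfl⟩,
    𝓔.exists_cuntzPimsner_equiv hP hproper⟩
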